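/- Let $m\ge 1$ and $n>d$, let $A\in\mathbb{R}^{n\times d}$ have rank $d$, let $\sigma_{\min}(A^TA)$ be the smallest eigenvalue of $A^TA$, and let $S\in\mathbb{R}^{m\times n}$ be a random matrix with i.i.d. entries $S_{ij}\sim\mathcal N(0,1/m)$ (a Gaussian sketch). For a convex set $\mathcal C\subseteq\mathbb{R}^d$ and $y\in\mathbb{R}^n$ write $x_{LS}=x_{LS}(y)=\arg\min_{x\in\mathcal C}\|Ax-y\|_2^2$ (when the minimizer exists) and $y^\perp=y-Ax_{LS}$. Let $\widetilde x=\widetilde x(SA,Sy)\in\mathbb{R}^d$ be any estimator of $x_{LS}$ that is a measurable function of the sketched data $(SA,Sy)$, biased or not; it may depend on $A$ and on the class of data vectors considered below. (a) Suppose $[-B,B]^d\subseteq\mathcal C$ for some $B>0$. Then for every $u\in\mathbb{R}^n$ with $A^Tu=0$, $$\sup_{y:\ y^\perp=u}\ \mathbb{E}\left[\|A(\widetilde x-x_{LS})\|_2^2\right]\ \ge\ \frac dm\|u\|_2^2\left(1-\frac{\pi^2\|u\|_2^2}{mB^2\sigma_{\min}(A^TA)}\right),$$ where the supremum is over all $y\in\mathbb{R}^n$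 for which $x_{LS}$ exists and $y^\perp=u$. Likewise, for every $r\ge 0$, the supremum of $\mathbb{E}[\|A(\widetilde x-x_{LS})\|_2^2]$ over all $y$ for which $x_{LS}$ exists and $\|y^\perp\|_2=r$ is at least $\frac dm r^2\left(1-\frac{\pi^2r^2}{mB^2\sigma_{\min}(A^TA)}\right)$. (b) In the unconstrained case $\mathcal C=\mathbb{R}^d$, the same two suprema are at least $\frac dm\|u\|_2^2$ and $\frac dm r^2$, respectively. -/

import Mathlib

open MeasureTheory ProbabilityTheory
open scoped ENNReal NNReal Matrix

/-- The Euclidean norm `‖v‖₂` of a vector in `ℝᵏ`. -/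
noncomputable def l2norm {k : ℕ} (v : Fin k → ℝ) : ℝ := ‖WithLp.toLp 2 v‖

/-- `x` solves the constrained least squares problem `min_{z ∈ C} ‖A z - y‖₂²`. -/
def IsLeastSquaresSolution {n d : ℕ} (A : Matrix (Fin n) (Fin d) ℝ) (C : Set (Fin d → ℝ))
    (y : Fin n → ℝ) (x : Fin d → ℝ) : Prop :=
  x ∈ C ∧ ∀ z ∈ C, l2norm (A *ᵥ x - y) ^ 2 ≤ l2norm (A *ᵥ z - y) ^ 2

/-- Matrices carry the product (entrywise Borel) sigma-algebra. -/
instance matrixMeasurableSpace (m n : ℕ) : MeasurableSpace (Matrix (Fin m) (Fin n) ℝ) :=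
  inferInstanceAs (MeasurableSpace (Fin m → Fin n → ℝ))

/-- Law of the `m × n` Gaussian sketching matrix: i.i.d. entries, each `N(0, 1/m)`. -/
noncomputable def gaussianSketch (m n : ℕ) : Measure (Matrix (Fin m) (Fin n) ℝ) :=
  Measure.pi fun _ : Fin m => Measure.pi fun _ : Fin n => gaussianReal 0 ((1 : ℝ≥0) / (m : ℝ≥0))

/-- An estimator computed from the sketched data: a function of the pair `(SA, Sy)`. -/
abbrev SketchEstimator (m d : ℕ) : Type :=
  Matrix (Fin m) (Fin d) ℝ × (Fin m → ℝ) → (Fin d → ℝ)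

/-- The prediction error `E ‖A (est (SA, Sy) - x)‖₂²` over the Gaussian sketch `S`
(a value in `[0, ∞]`). -/
noncomputable def predictionError {m n d : ℕ} (A : Matrix (Fin n) (Fin d) ℝ)
    (est : SketchEstimator m d) (y : Fin n → ℝ) (x : Fin d → ℝ) : ℝ≥0∞ :=
  ∫⁻ S, ENNReal.ofReal (l2norm (A *ᵥ (est (S * A, S *ᵥ y) - x)) ^ 2) ∂(gaussianSketch m n)

/-- The worst-case prediction error of `est` over all data vectors `y` whose least squares
solution `x` over `C` has a residual `y - A x` in the prescribed set `R`. -/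
noncomputable def worstCaseError {m n d : ℕ} (A : Matrix (Fin n) (Fin d) ℝ)
    (C : Set (Fin d → ℝ)) (R : Set (Fin n → ℝ)) (est : SketchEstimator m d) : ℝ≥0∞ :=
  ⨆ (y : Fin n → ℝ) (x : Fin d → ℝ) (_ : IsLeastSquaresSolution A C y x)
    (_ : y - A *ᵥ x ∈ R), predictionError A est y x

/-- `σ_min(AᵀA)`, the smallest eigenvalue of the Gram matrix `AᵀA`. -/
noncomputable def sigmaMinGram {n d : ℕ} (A : Matrix (Fin n) (Fin d) ℝ) : ℝ :=
  sInf {μ : ℝ | Module.End.HasEigenvalue (Matrix.toLin' (Aᵀ * A)) μ}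

/-! The supremum is bounded below by a Bayes risk, which the van Trees inequality controls. For `u`
orthogonal to the range of `A` and `x` in the cube, the data `y = A x + u` has least squares
solution `x` and residual `u`. With `Z = S A` and `w = S u` the sketched data is `(Z, Z x + w)`.
Since `Aᵀ u = 0`, the noise `w` is independent of `Z` and has i.i.d. entries of variance `v = ‖u‖² /
m` (`map_gaussianSketch`): this is a Gaussian linear model with random design.

Put on `x` a product prior with Fisher information `J` per coordinate. Let `D` be the estimation
error and `s` the score of the joint law of parameter and data. Integration by parts gives `E[Dᵢ sᵢ]
= 1`, whatever the bias (`integral_estimator_mul_jointScore`). Moreover `E[s sᵀ] = v⁻¹ AᵀA + J I`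
(`integral_jointScore_mul_jointScore`). Integrating the Young inequality `2 c D·s ≤ ‖A D‖² + c²
s·(AᵀA)⁻¹s` and optimising over `c` yields `E‖A D‖² ≥ d / (v⁻¹ + J / σ_min)`
(`le_integral_prediction_error`).

The squared cosine prior on `[-B, B]` has `J = π² / B²`, and `1 / (1 + t) ≥ 1 - t` gives the
constrained bound. In the unconstrained case `B` tends to infinity. -/

/-! ### Measures with densities, and logarithmic derivatives of products -/

theorem MeasureTheory.Measure.pi_withDensity_ofReal {ι : Type*} [Fintype ι] (g : ι → ℝ → ℝ)
    (hg : ∀ i, Integrable (g i)) (h0 : ∀ i t, 0 ≤ g i t) :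
    Measure.pi (fun i => (volume : Measure ℝ).withDensity fun t => ENNReal.ofReal (g i t)) =
      (volume : Measure (ι → ℝ)).withDensity fun x => ENNReal.ofReal (∏ i, g i (x i)) := by
  have hfin : ∀ i, IsFiniteMeasure
      ((volume : Measure ℝ).withDensity fun t => ENNReal.ofReal (g i t)) := fun i =>
    isFiniteMeasure_withDensity_ofReal (hg i).2
  refine (Measure.pi_eq fun s hs => ?_)
  rw [withDensity_apply _ (MeasurableSet.univ_pi hs),
    ← lintegral_indicator (MeasurableSet.univ_pi hs)]
  have hind : ∀ i, Integrable ((s i).indicator (g i)) := fun i => (hg i).indicator (hs i)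
  have hfun : ((Set.univ.pi s).indicator fun x : ι → ℝ => ENNReal.ofReal (∏ i, g i (x i))) =
      fun x => ENNReal.ofReal (∏ i, (s i).indicator (g i) (x i)) := by
    funext x
    by_cases hx : x ∈ Set.univ.pi s
    · rw [Set.indicator_of_mem hx]
      congr 1
      exact Finset.prod_congr rfl fun i _ => (Set.indicator_of_mem (hx i trivial) _).symm
    · rw [Set.indicator_of_notMem hx]
      obtain ⟨i, hi⟩ : ∃ i, x i ∉ s i := by simpa [Set.mem_pi] using hx
      rw [Finset.prod_eq_zero (Finset.mem_univ i) (Set.indicator_of_notMem hi _)]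
      simp
  rw [hfun, ← ofReal_integral_eq_lintegral_ofReal, integral_fintype_prod_volume_eq_prod,
    ENNReal.ofReal_prod_of_nonneg]
  · refine Finset.prod_congr rfl fun i _ => ?_
    rw [withDensity_apply _ (hs i), ← ofReal_integral_eq_lintegral_ofReal (hg i).integrableOn
      (.of_forall (h0 i)), integral_indicator (hs i)]
  · exact fun i _ => integral_nonneg fun t => Set.indicator_nonneg (fun t _ => h0 i t) t
  · exact Integrable.fintype_prod hind
  · exact .of_forall fun x => Finset.prod_nonneg fun i _ =>
      Set.indicator_nonneg (fun t _ => h0 i t) _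

theorem integrable_withDensity_ofReal_iff {α : Type*} {mα : MeasurableSpace α} {μ : Measure α}
    {g f : α → ℝ} (hg : Measurable g) (h0 : ∀ t, 0 ≤ g t) :
    Integrable f (μ.withDensity fun t => ENNReal.ofReal (g t)) ↔
      Integrable (fun t => g t * f t) μ := by
  rw [integrable_withDensity_iff_integrable_smul'
    hg.ennreal_ofReal (.of_forall fun _ => ENNReal.ofReal_lt_top)]
  simp [ENNReal.toReal_ofReal (h0 _)]

theorem integral_withDensity_ofReal {α : Type*} {mα : MeasurableSpace α} {μ : Measure α}
    {g f : α → ℝ} (hg : Measurable g) (h0 : ∀ t, 0 ≤ g t) :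
    ∫ t, f t ∂(μ.withDensity fun t => ENNReal.ofReal (g t)) = ∫ t, g t * f t ∂μ := by
  rw [integral_withDensity_eq_integral_toReal_smul
    hg.ennreal_ofReal (.of_forall fun _ => ENNReal.ofReal_lt_top)]
  simp [ENNReal.toReal_ofReal (h0 _)]

/-- Writing each derivative as `f * l` instead of dividing by `f` keeps the product rule valid at
zeros of the factors, which the compactly supported prior density has. -/
theorem HasDerivAt.finset_prod_log {ι : Type*} (s : Finset ι) {f : ι → ℝ → ℝ} {l : ι → ℝ} {x : ℝ}
    (h : ∀ i ∈ s, HasDerivAt (f i) (f i x * l i) x) :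
    HasDerivAt (fun t => ∏ i ∈ s, f i t) ((∏ i ∈ s, f i x) * ∑ i ∈ s, l i) x := by
  classical
  induction s using Finset.induction_on with
  | empty => simpa using hasDerivAt_const x (1 : ℝ)
  | insert a s ha ih =>
    simp only [Finset.prod_insert ha, Finset.sum_insert ha]
    have h1 := (h a (Finset.mem_insert_self a s)).mul
      (ih fun i hi => h i (Finset.mem_insert_of_mem hi))
    refine h1.congr_deriv ?_
    ring

/-! ### Priors on the line and their scores -/

/-- A continuous, compactly supported probability density `ρ` on the line with score function
`τ = ρ' / ρ` and Fisher information `J`. -/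
structure IsScoreDensity (ρ τ : ℝ → ℝ) (J : ℝ) : Prop where
  nonneg : ∀ t, 0 ≤ ρ t
  hasCompactSupport : HasCompactSupport ρ
  measurable_score : Measurable τ
  hasDerivAt : ∀ t, HasDerivAt ρ (ρ t * τ t) t
  integral_eq_one : ∫ t, ρ t = 1
  integrable_sq : Integrable fun t => ρ t * τ t ^ 2
  integral_sq : ∫ t, ρ t * τ t ^ 2 = J

/-- The probability measure on the line with density `ρ`. -/
noncomputable def densityMeasure (ρ : ℝ → ℝ) : Measure ℝ :=
  volume.withDensity fun t => ENNReal.ofReal (ρ t)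

namespace IsScoreDensity

variable {ρ τ : ℝ → ℝ} {J : ℝ}

theorem continuous (h : IsScoreDensity ρ τ J) : Continuous ρ :=
  continuous_iff_continuousAt.2 fun t => (h.hasDerivAt t).continuousAt

theorem integrable (h : IsScoreDensity ρ τ J) : Integrable ρ :=
  h.continuous.integrable_of_hasCompactSupport h.hasCompactSupport

theorem isProbabilityMeasure (h : IsScoreDensity ρ τ J) :
    IsProbabilityMeasure (densityMeasure ρ) := by
  constructor
  rw [densityMeasure, withDensity_apply _ MeasurableSet.univ, Measure.restrict_univ,
    ← ofReal_integral_eq_lintegral_ofReal h.integrable (.of_forall h.nonneg), h.integral_eq_one,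
    ENNReal.ofReal_one]

theorem integrable_densityMeasure_iff (h : IsScoreDensity ρ τ J) {f : ℝ → ℝ} :
    Integrable f (densityMeasure ρ) ↔ Integrable fun t => ρ t * f t := by
  simpa [densityMeasure] using
    integrable_withDensity_ofReal_iff (μ := volume) h.continuous.measurable h.nonneg

theorem integral_densityMeasure (h : IsScoreDensity ρ τ J) (f : ℝ → ℝ) :
    ∫ t, f t ∂densityMeasure ρ = ∫ t, ρ t * f t := by
  exact integral_withDensity_ofReal h.continuous.measurable h.nonneg

theorem memLp_score (h : IsScoreDensity ρ τ J) : MemLp τ 2 (densityMeasure ρ) :=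
  (memLp_two_iff_integrable_sq h.measurable_score.aestronglyMeasurable).2
    (h.integrable_densityMeasure_iff.2 h.integrable_sq)

theorem integral_score_sq (h : IsScoreDensity ρ τ J) : ∫ t, τ t ^ 2 ∂densityMeasure ρ = J := by
  rw [h.integral_densityMeasure, h.integral_sq]

theorem integral_score (h : IsScoreDensity ρ τ J) : ∫ t, τ t ∂densityMeasure ρ = 0 := by
  have := h.isProbabilityMeasure
  rw [h.integral_densityMeasure]
  exact integral_eq_zero_of_hasDerivAt_of_integrable h.hasDerivAt
    (h.integrable_densityMeasure_iff.1 (h.memLp_score.integrable one_le_two)) h.integrable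

end IsScoreDensity

/-! ### The joint score and integration by parts in the parameter -/

theorem hasDerivAt_gaussianPDFReal (v : ℝ≥0) (t : ℝ) :
    HasDerivAt (gaussianPDFReal 0 v) (gaussianPDFReal 0 v t * (-(t / v))) t := by
  have h1 : HasDerivAt (fun t : ℝ => -(t - 0) ^ 2 / (2 * (v : ℝ))) (-(t / v)) t := by
    have := ((((hasDerivAt_id t).sub_const 0).pow 2).neg).div_const (2 * (v : ℝ))
    refine this.congr_deriv ?_
    simp only [id]
    by_cases hv : (v : ℝ) = 0
    · simp [hv]
    · field_simp
      simp [mul_comm]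
  have h2 := (h1.exp).const_mul ((√(2 * Real.pi * v))⁻¹)
  rw [gaussianPDFReal_def]
  refine h2.congr_deriv ?_
  ring

theorem continuous_gaussianPDFReal (v : ℝ≥0) : Continuous (gaussianPDFReal 0 v) :=
  continuous_iff_continuousAt.2 fun t => (hasDerivAt_gaussianPDFReal v t).continuousAt

/-- The score in direction `i` of the joint law of a parameter `x` and of the data `Z x + w`, as a
function of the parameter and of the noise `w`. -/
noncomputable def jointScore {m d : ℕ} (v : ℝ) (τ : ℝ → ℝ) (Z : Matrix (Fin m) (Fin d) ℝ)
    (x : Fin d → ℝ) (w : Fin m → ℝ) (i : Fin d) : ℝ :=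
  v⁻¹ * ∑ k, Z k i * w k + τ (x i)

/-- The data `y` is held fixed, so the parameter enters both through the prior and through the noise
`y - Z x`; the two logarithmic derivatives add up to the score. -/
theorem hasLineDerivAt_jointDensity {m d : ℕ} {ρ τ : ℝ → ℝ} {J : ℝ} (h : IsScoreDensity ρ τ J)
    (v : ℝ≥0) (Z : Matrix (Fin m) (Fin d) ℝ) (y : Fin m → ℝ) (x : Fin d → ℝ) (i : Fin d) :
    HasLineDerivAt ℝ
      (fun x : Fin d → ℝ => (∏ j, ρ (x j)) * ∏ k, gaussianPDFReal 0 v ((y - Z *ᵥ x) k))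
      (((∏ j, ρ (x j)) * ∏ k, gaussianPDFReal 0 v ((y - Z *ᵥ x) k)) *
        jointScore v τ Z x (y - Z *ᵥ x) i) x (Pi.single i 1) := by
  have h1 : HasDerivAt (fun t : ℝ => ∏ j, ρ ((x + t • (Pi.single i 1 : Fin d → ℝ)) j))
      ((∏ j, ρ ((x + (0 : ℝ) • (Pi.single i 1 : Fin d → ℝ)) j)) *
        ∑ j, (if j = i then τ (x j) else 0)) 0 := by
    refine HasDerivAt.finset_prod_log _ fun j _ => ?_
    have hl : HasDerivAt (fun t : ℝ => (x + t • (Pi.single i 1 : Fin d → ℝ)) j)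
        ((Pi.single i 1 : Fin d → ℝ) j) 0 := by
      simpa using ((hasDerivAt_id (0 : ℝ)).mul_const ((Pi.single i 1 : Fin d → ℝ) j)).const_add (x j)
    have := (h.hasDerivAt ((x + (0 : ℝ) • (Pi.single i 1 : Fin d → ℝ)) j)).comp (0 : ℝ) hl
    refine this.congr_deriv ?_
    by_cases hj : j = i
    · subst hj; simp
    · simp [hj]
  have h2 : HasDerivAt (fun t : ℝ => ∏ k, gaussianPDFReal 0 v
        ((y - Z *ᵥ (x + t • (Pi.single i 1 : Fin d → ℝ))) k))
      ((∏ k, gaussianPDFReal 0 v ((y - Z *ᵥ (x + (0 : ℝ) • (Pi.single i 1 : Fin d → ℝ))) k)) *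
        ∑ k, (v : ℝ)⁻¹ * (Z k i * (y - Z *ᵥ x) k)) 0 := by
    refine HasDerivAt.finset_prod_log _ fun k _ => ?_
    have hl : HasDerivAt (fun t : ℝ => (y - Z *ᵥ (x + t • (Pi.single i 1 : Fin d → ℝ))) k)
        (-(Z k i)) 0 := by
      have := (((hasDerivAt_id (0 : ℝ)).mul_const (Z k i)).const_add ((Z *ᵥ x) k)).const_sub (y k)
      simpa [Matrix.mulVec_add, Matrix.mulVec_smul] using this
    have := (hasDerivAt_gaussianPDFReal v
      ((y - Z *ᵥ (x + (0 : ℝ) • (Pi.single i 1 : Fin d → ℝ))) k)).comp (0 : ℝ) hl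
    refine this.congr_deriv ?_
    simp only [zero_smul, add_zero]
    ring
  refine (h1.mul h2).congr_deriv ?_
  simp only [zero_smul, add_zero, jointScore, Finset.sum_ite_eq', Finset.mem_univ, if_true,
    ← Finset.mul_sum]
  ring

theorem prod_pi_densityMeasure_gaussianReal {m d : ℕ} {ρ τ : ℝ → ℝ} {J : ℝ}
    (h : IsScoreDensity ρ τ J) {v : ℝ≥0} (hv : v ≠ 0) :
    (Measure.pi fun _ : Fin d => densityMeasure ρ).prod
        (Measure.pi fun _ : Fin m => gaussianReal 0 v) =
      (volume.prod volume).withDensity fun z : (Fin d → ℝ) × (Fin m → ℝ) =>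
        ENNReal.ofReal ((∏ j, ρ (z.1 j)) * ∏ k, gaussianPDFReal 0 v (z.2 k)) := by
  have h1 : (Measure.pi fun _ : Fin d => densityMeasure ρ) =
      volume.withDensity fun x : Fin d → ℝ => ENNReal.ofReal (∏ j, ρ (x j)) :=
    Measure.pi_withDensity_ofReal (fun _ => ρ) (fun _ => h.integrable) fun _ => h.nonneg
  have h2 : (Measure.pi fun _ : Fin m => gaussianReal 0 v) =
      volume.withDensity fun w : Fin m → ℝ =>
        ENNReal.ofReal (∏ k, gaussianPDFReal 0 v (w k)) := by
    simp only [gaussianReal_of_var_ne_zero _ hv]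
    exact Measure.pi_withDensity_ofReal (fun _ => gaussianPDFReal 0 v)
      (fun _ => integrable_gaussianPDFReal 0 v) fun _ => gaussianPDFReal_nonneg 0 v
  have hρ := h.continuous
  have hφ := continuous_gaussianPDFReal v
  rw [h1, h2, prod_withDensity]
  · congr 1
    funext z
    rw [ENNReal.ofReal_mul (Finset.prod_nonneg fun j _ => h.nonneg _)]
  · exact (by fun_prop : Continuous fun x : Fin d → ℝ => ∏ j, ρ (x j)).measurable.ennreal_ofReal
  · exact (by fun_prop : Continuous fun w : Fin m → ℝ =>
      ∏ k, gaussianPDFReal 0 v (w k)).measurable.ennreal_ofReal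

theorem hasCompactSupport_prod_comp_apply {ι : Type*} [Fintype ι] {ρ : ℝ → ℝ}
    (hρ : HasCompactSupport ρ) : HasCompactSupport fun x : ι → ℝ => ∏ j, ρ (x j) := by
  refine HasCompactSupport.intro (isCompact_univ_pi fun _ : ι => hρ.isCompact) fun x hx => ?_
  obtain ⟨j, hj⟩ : ∃ j, x j ∉ tsupport ρ := by simpa [Set.mem_pi] using hx
  exact Finset.prod_eq_zero (Finset.mem_univ j) (image_eq_zero_of_notMem_tsupport hj)

/-- The shear `(x, w) ↦ (x, Z x + w)`, which maps parameter and noise to parameter and data. -/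
theorem measurePreserving_shear {m d : ℕ} (Z : Matrix (Fin m) (Fin d) ℝ) :
    MeasurePreserving (fun z : (Fin d → ℝ) × (Fin m → ℝ) => (z.1, Z *ᵥ z.1 + z.2))
      (volume.prod volume) (volume.prod volume) := by
  have hc : Continuous fun x : Fin d → ℝ => Z *ᵥ x := by fun_prop
  refine (MeasurePreserving.id volume).skew_product (g := fun x w => Z *ᵥ x + w) ?_ ?_
  · exact ((hc.comp continuous_fst).add continuous_snd).measurable
  · exact .of_forall fun x => map_add_left_eq_self volume _

/-- Along a measure preserving embedding, integrals transfer for arbitrary functions, so no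
measurability of the estimator is needed in the change of variables. -/
theorem measurableEmbedding_shear {m d : ℕ} (Z : Matrix (Fin m) (Fin d) ℝ) :
    MeasurableEmbedding (fun z : (Fin d → ℝ) × (Fin m → ℝ) => (z.1, Z *ᵥ z.1 + z.2)) := by
  have hc : Continuous fun x : Fin d → ℝ => Z *ᵥ x := by fun_prop
  have h1 := (hc.comp (continuous_fst (X := Fin d → ℝ) (Y := Fin m → ℝ)))
  let e : ((Fin d → ℝ) × (Fin m → ℝ)) ≃ₜ ((Fin d → ℝ) × (Fin m → ℝ)) :=
    { toFun := fun z => (z.1, Z *ᵥ z.1 + z.2)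
      invFun := fun z => (z.1, z.2 - Z *ᵥ z.1)
      left_inv := fun z => by simp
      right_inv := fun z => by simp
      continuous_toFun := continuous_fst.prodMk (h1.add continuous_snd)
      continuous_invFun := continuous_fst.prodMk (continuous_snd.sub h1) }
  exact e.measurableEmbedding

/-- After the shear to coordinates (parameter, data), Fubini fixes the data `y`, so that `e y` is
constant. Integrating `e y - x i` against the `i`-th derivative of the joint density moves the
derivative onto `-x i`, which leaves the total mass 1. There are no boundary terms because the prior
has compact support. -/
theorem integral_estimator_mul_jointScore {m d : ℕ} {ρ τ : ℝ → ℝ} {J : ℝ}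
    (h : IsScoreDensity ρ τ J) {v : ℝ≥0} (hv : v ≠ 0) (Z : Matrix (Fin m) (Fin d) ℝ)
    (e : (Fin m → ℝ) → ℝ) (i : Fin d)
    (hint : Integrable
      (fun z : (Fin d → ℝ) × (Fin m → ℝ) =>
        (e (Z *ᵥ z.1 + z.2) - z.1 i) * jointScore v τ Z z.1 z.2 i)
      ((Measure.pi fun _ : Fin d => densityMeasure ρ).prod
        (Measure.pi fun _ : Fin m => gaussianReal 0 v))) :
    ∫ z, (e (Z *ᵥ z.1 + z.2) - z.1 i) * jointScore v τ Z z.1 z.2 i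
      ∂((Measure.pi fun _ : Fin d => densityMeasure ρ).prod
        (Measure.pi fun _ : Fin m => gaussianReal 0 v)) = 1 := by
  have hρ := h.continuous
  have hφ := continuous_gaussianPDFReal v
  have := h.isProbabilityMeasure
  set q : (Fin d → ℝ) × (Fin m → ℝ) → ℝ := fun z =>
    (∏ j, ρ (z.1 j)) * ∏ k, gaussianPDFReal 0 v (z.2 k) with hq
  have hqc : Continuous q := by fun_prop
  have hq0 : ∀ z, 0 ≤ q z := fun z => mul_nonneg (Finset.prod_nonneg fun j _ => h.nonneg _)
    (Finset.prod_nonneg fun k _ => gaussianPDFReal_nonneg _ _ _)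
  have hone : Integrable q (volume.prod volume) ∧ ∫ z, q z ∂(volume.prod volume) = 1 := by
    have h1 : Integrable (fun _ : (Fin d → ℝ) × (Fin m → ℝ) => (1 : ℝ))
        ((Measure.pi fun _ : Fin d => densityMeasure ρ).prod
          (Measure.pi fun _ : Fin m => gaussianReal 0 v)) := integrable_const _
    have h2 : ∫ _, (1 : ℝ) ∂((Measure.pi fun _ : Fin d => densityMeasure ρ).prod
          (Measure.pi fun _ : Fin m => gaussianReal 0 v)) = 1 := by simp
    rw [prod_pi_densityMeasure_gaussianReal h hv,
      integrable_withDensity_ofReal_iff hqc.measurable hq0] at h1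
    rw [prod_pi_densityMeasure_gaussianReal h hv,
      integral_withDensity_ofReal hqc.measurable hq0] at h2
    simpa using And.intro h1 h2
  rw [prod_pi_densityMeasure_gaussianReal h hv,
    integrable_withDensity_ofReal_iff hqc.measurable hq0] at hint
  rw [prod_pi_densityMeasure_gaussianReal h hv,
    integral_withDensity_ofReal hqc.measurable hq0]
  set K : (Fin d → ℝ) × (Fin m → ℝ) → ℝ := fun z => q (z.1, z.2 - Z *ᵥ z.1) with hK
  set H : (Fin d → ℝ) × (Fin m → ℝ) → ℝ := fun z =>
    K z * ((e z.2 - z.1 i) * jointScore v τ Z z.1 (z.2 - Z *ᵥ z.1) i) with hH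
  set T : (Fin d → ℝ) × (Fin m → ℝ) → (Fin d → ℝ) × (Fin m → ℝ) :=
    fun z => (z.1, Z *ᵥ z.1 + z.2) with hT
  -- `K` and `H` are the joint density and the integrand in (parameter, data) coordinates; composing
  -- with the shear `T` returns to (parameter, noise).
  have hKT : (fun z => K (T z)) = q := by funext z; simp [hK, hT]
  have hHT : (fun z => H (T z)) = fun z =>
      q z * ((e (Z *ᵥ z.1 + z.2) - z.1 i) * jointScore v τ Z z.1 z.2 i) := by
    funext z; simp [hH, hK, hT]
  have hTm := measurePreserving_shear (m := m) Z
  have hTe := measurableEmbedding_shear (m := m) Z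
  have hKint : Integrable K (volume.prod volume) := by
    rw [← hTm.integrable_comp_emb hTe]
    change Integrable (fun z => K (T z)) _
    rw [hKT]; exact hone.1
  have hHint : Integrable H (volume.prod volume) := by
    rw [← hTm.integrable_comp_emb hTe]
    change Integrable (fun z => H (T z)) _
    rw [hHT]; exact hint
  have hK1 : ∫ z, K z ∂(volume.prod volume) = 1 := by
    rw [← hTm.integral_comp hTe]
    change ∫ z, K (T z) ∂_ = _
    rw [hKT]; exact hone.2
  have hgoal : ∫ z, H z ∂(volume.prod volume) = 1 := by
    rw [← hK1, integral_prod_symm _ hHint, integral_prod_symm _ hKint]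
    refine integral_congr_ae ?_
    filter_upwards [hHint.prod_left_ae, hKint.prod_left_ae] with y hHy hKy
    have hKc : Continuous fun x : Fin d → ℝ => K (x, y) := by
      have hc : Continuous fun x : Fin d → ℝ => Z *ᵥ x := by fun_prop
      exact hqc.comp (continuous_id.prodMk (continuous_const.sub hc))
    have hKs : HasCompactSupport fun x : Fin d → ℝ => K (x, y) :=
      (hasCompactSupport_prod_comp_apply h.hasCompactSupport).mul_right
    have hibp := integral_bilinear_hasLineDerivAt_right_eq_neg_left_of_integrable
      (μ := (volume : Measure (Fin d → ℝ))) (v := Pi.single i 1)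
      (B := ContinuousLinearMap.mul ℝ ℝ)
      (f := fun x : Fin d → ℝ => e y - x i) (f' := fun _ => -1)
      (g := fun x => K (x, y))
      (g' := fun x => K (x, y) * jointScore v τ Z x (y - Z *ᵥ x) i)
      (by simpa using hKy.neg)
      (by
        refine hHy.congr (.of_forall fun x => ?_)
        simp only [hH, ContinuousLinearMap.mul_apply']
        ring)
      (by
        have hc : Continuous fun x : Fin d → ℝ => (e y - x i) * K (x, y) := by fun_prop
        exact hc.integrable_of_hasCompactSupport hKs.mul_left)
      (fun x _ => by
        have := ((hasDerivAt_id (0 : ℝ)).mul_const ((Pi.single i 1 : Fin d → ℝ) i)).const_add (x i)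
        have := this.const_sub (e y)
        simpa [HasLineDerivAt] using this)
      (fun x _ => hasLineDerivAt_jointDensity h v Z y x i)
    calc ∫ x, H (x, y) = ∫ x, ContinuousLinearMap.mul ℝ ℝ (e y - x i)
          (K (x, y) * jointScore v τ Z x (y - Z *ᵥ x) i) := by
          refine integral_congr_ae (.of_forall fun x => ?_)
          simp only [hH, ContinuousLinearMap.mul_apply']
          ring
      _ = _ := hibp
      _ = _ := by rw [← integral_neg]; simp
  rw [← hTm.integral_comp hTe] at hgoal
  change ∫ z, H (T z) ∂_ = _ at hgoal
  rwa [hHT] at hgoal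

/-- The law of the design does not depend on the parameter, so it contributes nothing to the score
and the identity can be averaged over `Z`. -/
theorem integral_estimator_mul_jointScore_random_design {m d : ℕ} {ρ τ : ℝ → ℝ} {J : ℝ}
    (h : IsScoreDensity ρ τ J) {v : ℝ≥0} (hv : v ≠ 0) (Q : Measure (Matrix (Fin m) (Fin d) ℝ))
    [IsProbabilityMeasure Q] (e : Matrix (Fin m) (Fin d) ℝ × (Fin m → ℝ) → ℝ) (i : Fin d)
    (hint : Integrable
      (fun z : Matrix (Fin m) (Fin d) ℝ × (Fin d → ℝ) × (Fin m → ℝ) =>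
        (e (z.1, z.1 *ᵥ z.2.1 + z.2.2) - z.2.1 i) * jointScore v τ z.1 z.2.1 z.2.2 i)
      (Q.prod ((Measure.pi fun _ : Fin d => densityMeasure ρ).prod
        (Measure.pi fun _ : Fin m => gaussianReal 0 v)))) :
    ∫ z, (e (z.1, z.1 *ᵥ z.2.1 + z.2.2) - z.2.1 i) * jointScore v τ z.1 z.2.1 z.2.2 i
      ∂(Q.prod ((Measure.pi fun _ : Fin d => densityMeasure ρ).prod
        (Measure.pi fun _ : Fin m => gaussianReal 0 v))) = 1 := by
  have := h.isProbabilityMeasure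
  rw [integral_prod _ hint]
  have h1 : ∀ᵐ Z ∂Q, ∫ z, (e (Z, Z *ᵥ z.1 + z.2) - z.1 i) * jointScore v τ Z z.1 z.2 i
      ∂((Measure.pi fun _ : Fin d => densityMeasure ρ).prod
        (Measure.pi fun _ : Fin m => gaussianReal 0 v)) = 1 := by
    filter_upwards [hint.prod_right_ae] with Z hZ
    exact integral_estimator_mul_jointScore h hv Z (fun y => e (Z, y)) i hZ
  rw [integral_congr_ae h1]
  simp

/-! ### The squared cosine prior -/

/-- The squared cosine density on `[-B, B]`. -/
noncomputable def cosSqDensity (B t : ℝ) : ℝ :=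
  if t ∈ Set.Icc (-B) B then Real.cos (Real.pi / (2 * B) * t) ^ 2 / B else 0

/-- The score of the squared cosine density. -/
noncomputable def cosSqScore (B t : ℝ) : ℝ := -(Real.pi / B) * Real.tan (Real.pi / (2 * B) * t)

theorem cosSqDensity_of_mem {B t : ℝ} (ht : t ∈ Set.Icc (-B) B) :
    cosSqDensity B t = Real.cos (Real.pi / (2 * B) * t) ^ 2 / B := if_pos ht

theorem cosSqDensity_of_notMem {B t : ℝ} (ht : t ∉ Set.Icc (-B) B) : cosSqDensity B t = 0 :=
  if_neg ht

theorem cosSqDensity_eq_indicator (B : ℝ) :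
    cosSqDensity B = (Set.Icc (-B) B).indicator fun t =>
      Real.cos (Real.pi / (2 * B) * t) ^ 2 / B := by
  funext t
  simp only [cosSqDensity, Set.indicator_apply]

theorem hasDerivAt_cos_sq_div {B : ℝ} (hB : 0 < B) (t : ℝ) :
    HasDerivAt (fun t => Real.cos (Real.pi / (2 * B) * t) ^ 2 / B)
      (Real.cos (Real.pi / (2 * B) * t) ^ 2 / B * cosSqScore B t) t := by
  have h1 : HasDerivAt (fun t : ℝ => Real.pi / (2 * B) * t) (Real.pi / (2 * B)) t := by
    simpa using (hasDerivAt_id t).const_mul (Real.pi / (2 * B))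
  refine ((h1.cos.pow 2).div_const B).congr_deriv ?_
  rw [cosSqScore]
  by_cases hc : Real.cos (Real.pi / (2 * B) * t) = 0
  · simp [hc]
  · rw [Real.tan_eq_sin_div_cos]
    field_simp
    simp only [Nat.add_one_sub_one, pow_one]
    ring

theorem cos_boundary {B : ℝ} (hB : 0 < B) : Real.cos (Real.pi / (2 * B) * B) = 0 := by
  rw [show Real.pi / (2 * B) * B = Real.pi / 2 by field_simp, Real.cos_pi_div_two]

/-- The cosine vanishes at `±B`, so its square has zero one-sided derivatives there and glues
differentiably with 0. The value of the tangent at these points is irrelevant, being multiplied by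
0. -/
theorem hasDerivAt_cosSqDensity {B : ℝ} (hB : 0 < B) (t : ℝ) :
    HasDerivAt (cosSqDensity B) (cosSqDensity B t * cosSqScore B t) t := by
  have hB0 : cosSqDensity B B = 0 := by
    rw [cosSqDensity_of_mem ⟨by linarith, le_rfl⟩, cos_boundary hB]; simp
  have hBn : cosSqDensity B (-B) = 0 := by
    rw [cosSqDensity_of_mem ⟨le_rfl, by linarith⟩, mul_neg, Real.cos_neg, cos_boundary hB]; simp
  have hsmooth : ∀ s ⊆ Set.Icc (-B) B, ∀ t ∈ s,
      HasDerivWithinAt (cosSqDensity B) (cosSqDensity B t * cosSqScore B t) s t := by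
    intro s hs t ht
    rw [cosSqDensity_of_mem (hs ht)]
    exact (hasDerivAt_cos_sq_div hB t).hasDerivWithinAt.congr
      (fun x hx => cosSqDensity_of_mem (hs hx)) (cosSqDensity_of_mem (hs ht))
  have hzero : ∀ s : Set ℝ, (∀ x ∈ s, cosSqDensity B x = 0) → ∀ t ∈ s,
      HasDerivWithinAt (cosSqDensity B) (cosSqDensity B t * cosSqScore B t) s t := by
    intro s hs t ht
    rw [hs t ht, zero_mul]
    exact (hasDerivWithinAt_const t s (0 : ℝ)).congr (fun x hx => hs x hx) (hs t ht)
  have hout : ∀ x, x ≤ -B ∨ B ≤ x → cosSqDensity B x = 0 := by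
    rintro x (hx | hx)
    · rcases hx.eq_or_lt with rfl | hx
      · exact hBn
      · exact cosSqDensity_of_notMem fun h => by linarith [h.1]
    · rcases hx.eq_or_lt with rfl | hx
      · exact hB0
      · exact cosSqDensity_of_notMem fun h => by linarith [h.2]
  rcases lt_trichotomy t (-B) with ht | rfl | ht
  · exact (hzero (Set.Iic (-B)) (fun x hx => hout x (.inl hx)) t ht.le).hasDerivAt
      (Iic_mem_nhds ht)
  · refine ((hzero (Set.Iic (-B)) (fun x hx => hout x (.inl hx)) _ Set.self_mem_Iic).union
      (hsmooth (Set.Icc (-B) B) subset_rfl _ ⟨le_rfl, by linarith⟩)).hasDerivAt ?_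
    rw [Set.Iic_union_Icc_eq_Iic (by linarith)]
    exact Iic_mem_nhds (by linarith)
  · rcases lt_trichotomy t B with ht' | rfl | ht'
    · exact (hsmooth (Set.Icc (-B) B) subset_rfl t ⟨ht.le, ht'.le⟩).hasDerivAt
        (Icc_mem_nhds ht ht')
    · refine ((hsmooth (Set.Icc (-t) t) subset_rfl _ ⟨ht.le, le_rfl⟩).union
        (hzero (Set.Ici t) (fun x hx => hout x (.inr hx)) _ Set.self_mem_Ici)).hasDerivAt ?_
      rw [Set.Icc_union_Ici_eq_Ici (by linarith)]
      exact Ici_mem_nhds ht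
    · exact (hzero (Set.Ici B) (fun x hx => hout x (.inr hx)) t ht'.le).hasDerivAt
        (Ici_mem_nhds ht')

/-- The identity is only almost everywhere: at `±B` the left side is 0 while the sine on the right
is `±1`. -/
theorem cosSqDensity_mul_sq_score {B : ℝ} (hB : 0 < B) :
    ∀ᵐ t, cosSqDensity B t * cosSqScore B t ^ 2 =
      (Set.Icc (-B) B).indicator
        (fun t => Real.pi ^ 2 / B ^ 3 * Real.sin (Real.pi / (2 * B) * t) ^ 2) t := by
  have hae : ∀ᵐ t : ℝ, t ∉ ({-B, B} : Set ℝ) :=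
    (Set.toFinite ({-B, B} : Set ℝ)).countable.ae_notMem volume
  filter_upwards [hae] with t ht
  by_cases hm : t ∈ Set.Icc (-B) B
  · have h1 : -B < t := lt_of_le_of_ne hm.1 fun h => ht (by simp [← h])
    have h2 : t < B := lt_of_le_of_ne hm.2 fun h => ht (by simp [h])
    have hc : 0 < Real.cos (Real.pi / (2 * B) * t) := by
      refine Real.cos_pos_of_mem_Ioo ⟨?_, ?_⟩
      · rw [show -(Real.pi / 2) = Real.pi / (2 * B) * (-B) by field_simp]
        exact mul_lt_mul_of_pos_left h1 (by positivity)
      · rw [show Real.pi / 2 = Real.pi / (2 * B) * B by field_simp]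
        exact mul_lt_mul_of_pos_left h2 (by positivity)
    rw [cosSqDensity_of_mem hm, Set.indicator_of_mem hm, cosSqScore, Real.tan_eq_sin_div_cos]
    generalize Real.pi / (2 * B) * t = a at hc
    field_simp
  · rw [cosSqDensity_of_notMem hm, Set.indicator_of_notMem hm, zero_mul]

/-- The Fisher information is `π² / B³` times the integral of the squared sine over `[-B, B]`, which
equals `B`; this is the source of `π²` in the final bound. -/
theorem isScoreDensity_cosSqDensity {B : ℝ} (hB : 0 < B) :
    IsScoreDensity (cosSqDensity B) (cosSqScore B) (Real.pi ^ 2 / B ^ 2) where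
  nonneg t := by
    rw [cosSqDensity]; split_ifs <;> positivity
  hasCompactSupport := HasCompactSupport.intro isCompact_Icc fun _ ht => cosSqDensity_of_notMem ht
  measurable_score := by
    have : Measurable Real.tan := by
      have : Real.tan = fun x => Real.sin x / Real.cos x := by
        funext x; exact Real.tan_eq_sin_div_cos x
      rw [this]; exact Real.measurable_sin.div Real.measurable_cos
    unfold cosSqScore
    fun_prop
  hasDerivAt := hasDerivAt_cosSqDensity hB
  integral_eq_one := by
    rw [cosSqDensity_eq_indicator, integral_indicator measurableSet_Icc,
      integral_Icc_eq_integral_Ioc, ← intervalIntegral.integral_of_le (by linarith)]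
    have hd : ∀ t ∈ Set.uIcc (-B) B, HasDerivAt
        (fun t => t / (2 * B) + Real.sin (Real.pi / B * t) / (2 * Real.pi))
        (Real.cos (Real.pi / (2 * B) * t) ^ 2 / B) t := by
      intro t _
      have h1 : HasDerivAt (fun t : ℝ => Real.pi / B * t) (Real.pi / B) t := by
        simpa using (hasDerivAt_id t).const_mul (Real.pi / B)
      refine (((hasDerivAt_id t).div_const (2 * B)).add
        (h1.sin.div_const (2 * Real.pi))).congr_deriv ?_
      rw [show Real.pi / B * t = 2 * (Real.pi / (2 * B) * t) by field_simp, Real.cos_two_mul]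
      field_simp
      ring
    rw [intervalIntegral.integral_eq_sub_of_hasDerivAt hd
      (Continuous.intervalIntegrable (by fun_prop) _ _)]
    rw [show Real.pi / B * B = Real.pi by field_simp,
      show Real.pi / B * -B = -Real.pi by field_simp, Real.sin_neg, Real.sin_pi]
    field_simp
    ring
  integrable_sq := by
    refine Integrable.congr ?_ ((cosSqDensity_mul_sq_score hB).mono fun t ht => ht.symm)
    refine IntegrableOn.integrable_indicator ?_ measurableSet_Icc
    exact (by fun_prop : Continuous fun t : ℝ =>
      Real.pi ^ 2 / B ^ 3 * Real.sin (Real.pi / (2 * B) * t) ^ 2).integrableOn_Icc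
  integral_sq := by
    rw [integral_congr_ae (cosSqDensity_mul_sq_score hB), integral_indicator measurableSet_Icc,
      integral_Icc_eq_integral_Ioc, ← intervalIntegral.integral_of_le (by linarith)]
    have hd : ∀ t ∈ Set.uIcc (-B) B, HasDerivAt
        (fun t => Real.pi ^ 2 / B ^ 3 * (t / 2 - B / (2 * Real.pi) * Real.sin (Real.pi / B * t)))
        (Real.pi ^ 2 / B ^ 3 * Real.sin (Real.pi / (2 * B) * t) ^ 2) t := by
      intro t _
      have h1 : HasDerivAt (fun t : ℝ => Real.pi / B * t) (Real.pi / B) t := by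
        simpa using (hasDerivAt_id t).const_mul (Real.pi / B)
      refine ((((hasDerivAt_id t).div_const 2).sub
        (h1.sin.const_mul (B / (2 * Real.pi)))).const_mul _).congr_deriv ?_
      rw [show Real.pi / B * t = 2 * (Real.pi / (2 * B) * t) by field_simp, Real.cos_two_mul,
        Real.sin_sq]
      field_simp
      ring
    rw [intervalIntegral.integral_eq_sub_of_hasDerivAt hd
      (Continuous.intervalIntegrable (by fun_prop) _ _)]
    rw [show Real.pi / B * B = Real.pi by field_simp,
      show Real.pi / B * -B = -Real.pi by field_simp, Real.sin_neg, Real.sin_pi]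
    field_simp
    ring

/-! ### Second moments of the joint score -/

theorem memLp_eval_gaussian {ι : Type*} [Fintype ι] (v : ℝ≥0) (k : ι) :
    MemLp (fun w : ι → ℝ => w k) 2 (Measure.pi fun _ : ι => gaussianReal 0 v) :=
  (memLp_id_gaussianReal' 2 (by simp)).comp_measurePreserving
    (measurePreserving_eval (fun _ : ι => gaussianReal 0 v) k)

theorem integral_eval_mul_eval_of_centered {ι : Type*} [Fintype ι] [DecidableEq ι]
    {μ : Measure ℝ} [IsProbabilityMeasure μ] {f : ℝ → ℝ} (hf : AEStronglyMeasurable f μ)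
    (h0 : ∫ t, f t ∂μ = 0) (k l : ι) :
    ∫ w, f (w k) * f (w l) ∂(Measure.pi fun _ : ι => μ) =
      if k = l then ∫ t, f t ^ 2 ∂μ else 0 := by
  split_ifs with hkl
  · subst hkl
    simp only [← pow_two]
    exact integral_comp_eval (μ := fun _ : ι => μ) (f := fun t => f t ^ 2) (hf.pow 2)
  -- Padding with factors 1 gives a product over all coordinates, to which Fubini applies; the
  -- factor at `k` integrates to 0.
  · have hprod : ∀ w : ι → ℝ, f (w k) * f (w l) =
        ∏ i, (if i = k ∨ i = l then f (w i) else 1) := by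
      intro w
      rw [← Finset.prod_filter, show (Finset.univ.filter fun i => i = k ∨ i = l) = {k, l} by
        ext; simp, Finset.prod_pair hkl]
    simp only [hprod]
    have := integral_fintype_prod_eq_prod (μ := fun _ : ι => μ)
      (fun i t => if i = k ∨ i = l then f t else 1)
    rw [this]
    exact Finset.prod_eq_zero (Finset.mem_univ k) (by simpa using h0)

theorem integral_sq_gaussianReal (v : ℝ≥0) : ∫ t, t ^ 2 ∂gaussianReal 0 v = v := by
  have h := variance_fun_id_gaussianReal (μ := 0) (v := v)
  rwa [variance_of_integral_eq_zero (by fun_prop) integral_id_gaussianReal] at h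

theorem integral_eval_mul_eval_gaussian {ι : Type*} [Fintype ι] [DecidableEq ι] (v : ℝ≥0)
    (k l : ι) : ∫ w : ι → ℝ, w k * w l ∂(Measure.pi fun _ : ι => gaussianReal 0 v) =
      if k = l then (v : ℝ) else 0 := by
  rw [← integral_sq_gaussianReal v]
  exact integral_eval_mul_eval_of_centered (f := fun t => t) (by fun_prop)
    integral_id_gaussianReal k l

theorem integral_eval_gaussian {ι : Type*} [Fintype ι] (v : ℝ≥0)
    (k : ι) : ∫ w : ι → ℝ, w k ∂(Measure.pi fun _ : ι => gaussianReal 0 v) = 0 := by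
  rw [integral_comp_eval (μ := fun _ : ι => gaussianReal 0 v) (f := fun t => t) (by fun_prop)]
  exact integral_id_gaussianReal

theorem integral_add_add_add {α : Type*} {mα : MeasurableSpace α} {μ : Measure α}
    {a b c d : α → ℝ} (ha : Integrable a μ) (hb : Integrable b μ) (hc : Integrable c μ)
    (hd : Integrable d μ) :
    ∫ x, a x + b x + c x + d x ∂μ =
      (∫ x, a x ∂μ) + (∫ x, b x ∂μ) + (∫ x, c x ∂μ) + ∫ x, d x ∂μ := by
  rw [integral_add (f := fun x => a x + b x + c x) ((ha.add hb).add hc) hd,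
    integral_add (f := fun x => a x + b x) (ha.add hb) hc, integral_add ha hb]

/-- The factors depend on independent variables, so the integral of the square factorises and no
higher moments are needed. -/
theorem MeasureTheory.MemLp.mul_prod_two {α β : Type*} {mα : MeasurableSpace α}
    {mβ : MeasurableSpace β} {μ : Measure α} {ν : Measure β} [SFinite μ] [SFinite ν]
    {f : α → ℝ} {g : β → ℝ} (hf : MemLp f 2 μ) (hg : MemLp g 2 ν) :
    MemLp (fun z : α × β => f z.1 * g z.2) 2 (μ.prod ν) := by
  refine (memLp_two_iff_integrable_sq (f := fun z : α × β => f z.1 * g z.2)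
    (hf.aestronglyMeasurable.comp_fst.mul hg.aestronglyMeasurable.comp_snd)).2 ?_
  simp only [mul_pow]
  exact hf.integrable_sq.mul_prod hg.integrable_sq

section SecondMoment

variable {m d : ℕ} {ρ τ : ℝ → ℝ} {J : ℝ} {Q : Measure (Matrix (Fin m) (Fin d) ℝ)}
  [IsProbabilityMeasure Q]

theorem memLp_jointScore (h : IsScoreDensity ρ τ J) (v : ℝ≥0)
    (hQ : ∀ k i, MemLp (fun Z : Matrix (Fin m) (Fin d) ℝ => Z k i) 2 Q) (i : Fin d) :
    MemLp (fun z : Matrix (Fin m) (Fin d) ℝ × (Fin d → ℝ) × (Fin m → ℝ) =>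
        jointScore v τ z.1 z.2.1 z.2.2 i) 2
      (Q.prod ((Measure.pi fun _ : Fin d => densityMeasure ρ).prod
        (Measure.pi fun _ : Fin m => gaussianReal 0 v))) := by
  have := h.isProbabilityMeasure
  have hw : ∀ k, MemLp (fun z : (Fin d → ℝ) × (Fin m → ℝ) => z.2 k) 2
      ((Measure.pi fun _ : Fin d => densityMeasure ρ).prod
        (Measure.pi fun _ : Fin m => gaussianReal 0 v)) := fun k =>
    (memLp_eval_gaussian v k).comp_snd _
  have hτ : MemLp (fun x : Fin d → ℝ => τ (x i)) 2 (Measure.pi fun _ : Fin d => densityMeasure ρ) :=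
    h.memLp_score.comp_measurePreserving (measurePreserving_eval _ i)
  have h1 : MemLp (fun z : Matrix (Fin m) (Fin d) ℝ × (Fin d → ℝ) × (Fin m → ℝ) =>
        (v : ℝ)⁻¹ * ∑ k, z.1 k i * z.2.2 k) 2
      (Q.prod ((Measure.pi fun _ : Fin d => densityMeasure ρ).prod
        (Measure.pi fun _ : Fin m => gaussianReal 0 v))) :=
    (memLp_finsetSum _ fun k _ => (hQ k i).mul_prod_two (hw k)).const_mul _
  exact h1.add ((hτ.comp_fst _).comp_snd _)

/-- The mixed terms vanish because the noise is centred and independent of design and prior. The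
noise part gives `v⁻² * v * M`, and distinct prior coordinates have uncorrelated scores, leaving `J`
on the diagonal. -/
theorem integral_jointScore_mul_jointScore (h : IsScoreDensity ρ τ J) {v : ℝ≥0} (hv : v ≠ 0)
    (hQ : ∀ k i, MemLp (fun Z : Matrix (Fin m) (Fin d) ℝ => Z k i) 2 Q)
    {M : Matrix (Fin d) (Fin d) ℝ} (hM : ∀ i j, ∑ k, ∫ Z, Z k i * Z k j ∂Q = M i j)
    (i j : Fin d) :
    ∫ z, jointScore v τ z.1 z.2.1 z.2.2 i * jointScore v τ z.1 z.2.1 z.2.2 j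
      ∂(Q.prod ((Measure.pi fun _ : Fin d => densityMeasure ρ).prod
        (Measure.pi fun _ : Fin m => gaussianReal 0 v))) =
      (v : ℝ)⁻¹ * M i j + J * (1 : Matrix (Fin d) (Fin d) ℝ) i j := by
  have := h.isProbabilityMeasure
  set π₀ := Measure.pi fun _ : Fin d => densityMeasure ρ with hπ₀
  set G := Measure.pi fun _ : Fin m => gaussianReal 0 v with hG
  have hτ : ∀ i, MemLp (fun x : Fin d → ℝ => τ (x i)) 2 π₀ := fun i =>
    h.memLp_score.comp_measurePreserving (measurePreserving_eval _ i)
  have hw : ∀ k, MemLp (fun w : Fin m → ℝ => w k) 2 G := memLp_eval_gaussian v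
  have hint : ∀ {a : Matrix (Fin m) (Fin d) ℝ → ℝ} {b : (Fin d → ℝ) → ℝ} {c : (Fin m → ℝ) → ℝ},
      Integrable a Q → Integrable b π₀ → Integrable c G →
      Integrable (fun z : Matrix (Fin m) (Fin d) ℝ × (Fin d → ℝ) × (Fin m → ℝ) =>
        a z.1 * (b z.2.1 * c z.2.2)) (Q.prod (π₀.prod G)) :=
    fun ha hb hc => ha.mul_prod (hb.mul_prod hc)
  have hval : ∀ (a : Matrix (Fin m) (Fin d) ℝ → ℝ) (b : (Fin d → ℝ) → ℝ) (c : (Fin m → ℝ) → ℝ),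
      ∫ z, a z.1 * (b z.2.1 * c z.2.2) ∂(Q.prod (π₀.prod G)) =
        (∫ Z, a Z ∂Q) * ((∫ x, b x ∂π₀) * ∫ w, c w ∂G) := fun a b c => by
    rw [integral_prod_mul a (fun z : (Fin d → ℝ) × (Fin m → ℝ) => b z.1 * c z.2),
      integral_prod_mul b c]
  have hone : Integrable (fun _ : Fin d → ℝ => (1 : ℝ)) π₀ := integrable_const _
  have hone' : Integrable (fun _ : Matrix (Fin m) (Fin d) ℝ => (1 : ℝ)) Q := integrable_const _
  have hone'' : Integrable (fun _ : Fin m → ℝ => (1 : ℝ)) G := integrable_const _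
  -- Every summand has the shape `a Z * (b x * c w)`, with dummy factors 1, so that `hint` and
  -- `hval` apply.
  have hexp : ∀ z : Matrix (Fin m) (Fin d) ℝ × (Fin d → ℝ) × (Fin m → ℝ),
      jointScore v τ z.1 z.2.1 z.2.2 i * jointScore v τ z.1 z.2.1 z.2.2 j =
      (v : ℝ)⁻¹ ^ 2 * ∑ k, ∑ l, (z.1 k i * z.1 l j) * (1 * (z.2.2 k * z.2.2 l)) +
      (v : ℝ)⁻¹ * (∑ k, z.1 k i * (τ (z.2.1 j) * z.2.2 k)) +
      (v : ℝ)⁻¹ * (∑ k, z.1 k j * (τ (z.2.1 i) * z.2.2 k)) +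
      1 * ((τ (z.2.1 i) * τ (z.2.1 j)) * 1) := by
    intro z
    have e1 : ∑ k, ∑ l, (z.1 k i * z.1 l j) * (1 * (z.2.2 k * z.2.2 l)) =
        (∑ k, z.1 k i * z.2.2 k) * ∑ l, z.1 l j * z.2.2 l := by
      rw [Finset.sum_mul_sum]
      exact Finset.sum_congr rfl fun k _ => Finset.sum_congr rfl fun l _ => by ring
    have e2 : ∀ i j, ∑ k, z.1 k i * (τ (z.2.1 j) * z.2.2 k) =
        (∑ k, z.1 k i * z.2.2 k) * τ (z.2.1 j) := by
      intro i j
      rw [Finset.sum_mul]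
      exact Finset.sum_congr rfl fun k _ => by ring
    rw [e1, e2, e2, jointScore, jointScore]
    ring
  have i1 : ∀ k l, Integrable (fun z : Matrix (Fin m) (Fin d) ℝ × (Fin d → ℝ) × (Fin m → ℝ) =>
      (z.1 k i * z.1 l j) * (1 * (z.2.2 k * z.2.2 l))) (Q.prod (π₀.prod G)) := fun k l =>
    hint ((hQ k i).integrable_mul (hQ l j)) hone ((hw k).integrable_mul (hw l))
  have i2 : ∀ i j k, Integrable (fun z : Matrix (Fin m) (Fin d) ℝ × (Fin d → ℝ) × (Fin m → ℝ) =>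
      z.1 k i * (τ (z.2.1 j) * z.2.2 k)) (Q.prod (π₀.prod G)) := fun i j k =>
    hint ((hQ k i).integrable one_le_two) ((hτ j).integrable one_le_two)
      ((hw k).integrable one_le_two)
  have i3 : Integrable (fun z : Matrix (Fin m) (Fin d) ℝ × (Fin d → ℝ) × (Fin m → ℝ) =>
      1 * ((τ (z.2.1 i) * τ (z.2.1 j)) * 1)) (Q.prod (π₀.prod G)) :=
    hint hone' ((hτ i).integrable_mul (hτ j)) hone''
  have I1 := (integrable_finsetSum Finset.univ fun k _ =>
    integrable_finsetSum Finset.univ fun l _ => i1 k l).const_mul ((v : ℝ)⁻¹ ^ 2)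
  have I2 : ∀ i j, _ := fun i j => (integrable_finsetSum Finset.univ fun k _ =>
    i2 i j k).const_mul ((v : ℝ)⁻¹)
  have v1 : ∀ k l, ∫ z, (z.1 k i * z.1 l j) * (1 * (z.2.2 k * z.2.2 l)) ∂(Q.prod (π₀.prod G)) =
      if k = l then (∫ Z, Z k i * Z k j ∂Q) * v else 0 := fun k l => by
    rw [hval (fun Z => Z k i * Z l j) (fun _ => 1) (fun w => w k * w l),
      integral_eval_mul_eval_gaussian]
    split_ifs with hkl
    · subst hkl; simp
    · simp
  have v2 : ∀ i j k, ∫ z, z.1 k i * (τ (z.2.1 j) * z.2.2 k) ∂(Q.prod (π₀.prod G)) = 0 :=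
    fun i j k => by
      rw [hval (fun Z => Z k i) (fun x => τ (x j)) (fun w => w k), integral_eval_gaussian]
      simp
  have v3 : ∫ z, 1 * ((τ (z.2.1 i) * τ (z.2.1 j)) * 1) ∂(Q.prod (π₀.prod G)) =
      J * (1 : Matrix (Fin d) (Fin d) ℝ) i j := by
    rw [hval (fun _ => 1) (fun x => τ (x i) * τ (x j)) (fun _ => 1),
      integral_eval_mul_eval_of_centered h.measurable_score.aestronglyMeasurable h.integral_score,
      h.integral_score_sq, Matrix.one_apply]
    split_ifs <;> simp
  simp only [hexp]
  rw [integral_add_add_add I1 (I2 i j) (I2 j i) i3, v3, integral_const_mul, integral_const_mul, integral_const_mul,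
    integral_finsetSum _ fun k _ => i2 i j k, integral_finsetSum _ fun k _ => i2 j i k,
    integral_finsetSum _ fun k _ => integrable_finsetSum _ fun l _ => i1 k l]
  simp only [v2, integral_finsetSum _ fun l _ => i1 _ l, v1, Finset.sum_const_zero,
    Finset.sum_ite_eq, Finset.mem_univ, if_true]
  rw [← Finset.sum_mul, hM]
  have : (v : ℝ) ≠ 0 := by exact_mod_cast hv
  field_simp
  ring

end SecondMoment

/-! ### One row of the Gaussian sketch -/

section GaussianRow

variable {n : ℕ} (v : ℝ≥0)

theorem memLp_dotProduct_gaussian (a : Fin n → ℝ) :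
    MemLp (fun s : Fin n → ℝ => s ⬝ᵥ a) 2 (Measure.pi fun _ : Fin n => gaussianReal 0 v) := by
  unfold dotProduct
  exact memLp_finsetSum _ fun k _ => (memLp_eval_gaussian v k).mul_const _

theorem integral_dotProduct_gaussian (a : Fin n → ℝ) :
    ∫ s, s ⬝ᵥ a ∂(Measure.pi fun _ : Fin n => gaussianReal 0 v) = 0 := by
  unfold dotProduct
  rw [integral_finsetSum _ fun k _ =>
    ((memLp_eval_gaussian v k).integrable one_le_two).mul_const _]
  simp [integral_mul_const, integral_eval_gaussian]

theorem integral_dotProduct_mul_dotProduct_gaussian (a b : Fin n → ℝ) :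
    ∫ s, (s ⬝ᵥ a) * (s ⬝ᵥ b) ∂(Measure.pi fun _ : Fin n => gaussianReal 0 v) =
      v * (a ⬝ᵥ b) := by
  have hi : ∀ k l, Integrable (fun s : Fin n → ℝ => s k * s l * (a k * b l))
      (Measure.pi fun _ : Fin n => gaussianReal 0 v) := fun k l =>
    ((memLp_eval_gaussian v k).integrable_mul (memLp_eval_gaussian v l)).mul_const _
  have hexp : ∀ s : Fin n → ℝ, (s ⬝ᵥ a) * (s ⬝ᵥ b) =
      ∑ k, ∑ l, s k * s l * (a k * b l) := fun s => by
    rw [dotProduct, dotProduct, Finset.sum_mul_sum]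
    exact Finset.sum_congr rfl fun k _ => Finset.sum_congr rfl fun l _ => by ring
  simp only [hexp]
  rw [integral_finsetSum _ fun k _ => integrable_finsetSum _ fun l _ => hi k l]
  simp only [integral_finsetSum _ fun l _ => hi _ l, integral_mul_const,
    integral_eval_mul_eval_gaussian, ite_mul, zero_mul, Finset.sum_ite_eq, Finset.mem_univ, if_true,
    dotProduct, Finset.mul_sum]

theorem covariance_dotProduct_gaussian (a b : Fin n → ℝ) :
    cov[fun s => s ⬝ᵥ a, fun s => s ⬝ᵥ b; Measure.pi fun _ : Fin n => gaussianReal 0 v] =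
      v * (a ⬝ᵥ b) := by
  rw [covariance_eq_sub (memLp_dotProduct_gaussian v a) (memLp_dotProduct_gaussian v b),
    integral_dotProduct_gaussian, zero_mul, sub_zero]
  exact integral_dotProduct_mul_dotProduct_gaussian v a b

instance isGaussian_pi_gaussianReal : IsGaussian (Measure.pi fun _ : Fin n => gaussianReal 0 v) := by
  have h : iIndepFun (fun (i : Fin n) (s : Fin n → ℝ) => id (s i))
      (Measure.pi fun _ : Fin n => gaussianReal 0 v) := iIndepFun_pi fun _ => aemeasurable_id
  have h2 := h.hasGaussianLaw fun i => by
    have hl : HasLaw (fun s : Fin n → ℝ => id (s i)) (gaussianReal 0 v)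
        (Measure.pi fun _ : Fin n => gaussianReal 0 v) :=
      ⟨(measurable_pi_apply i).aemeasurable, (measurePreserving_eval (fun _ : Fin n => gaussianReal 0 v) i).map_eq⟩
    exact hl.hasGaussianLaw
  have h3 := h2.isGaussian_map
  simpa using h3

theorem map_dotProduct_gaussian (u : Fin n → ℝ) {r : ℝ≥0} (hr : (r : ℝ) = v * (u ⬝ᵥ u)) :
    (Measure.pi fun _ : Fin n => gaussianReal 0 v).map (fun s => s ⬝ᵥ u) = gaussianReal 0 r := by
  have h : HasGaussianLaw (fun s : Fin n → ℝ => s ⬝ᵥ u)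
      (Measure.pi fun _ : Fin n => gaussianReal 0 v) := by
    have hid : HasGaussianLaw id (Measure.pi fun _ : Fin n => gaussianReal 0 v) :=
      IsGaussian.hasGaussianLaw_id
    exact hid.map_fun (LinearMap.toContinuousLinearMap
      ((dotProductBilin ℝ ℝ).flip u))
  rw [h.map_eq_gaussianReal, integral_dotProduct_gaussian, ← covariance_self (by fun_prop),
    covariance_dotProduct_gaussian, ← hr, Real.toNNReal_coe]

/-- The two images are jointly Gaussian with covariances `v * (Aᵀ u) i = 0`, and uncorrelated
jointly Gaussian vectors are independent. -/
theorem map_vecMul_dotProduct_gaussian {d : ℕ} (A : Matrix (Fin n) (Fin d) ℝ) (u : Fin n → ℝ)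
    (hu : Aᵀ *ᵥ u = 0) {r : ℝ≥0} (hr : (r : ℝ) = v * (u ⬝ᵥ u)) :
    (Measure.pi fun _ : Fin n => gaussianReal 0 v).map (fun s => (s ᵥ* A, s ⬝ᵥ u)) =
      ((Measure.pi fun _ : Fin n => gaussianReal 0 v).map fun s => s ᵥ* A).prod
        (gaussianReal 0 r) := by
  have hm1 : Measurable fun s : Fin n → ℝ => s ᵥ* A :=
    (by fun_prop : Continuous fun s : Fin n → ℝ => s ᵥ* A).measurable
  have hm2 : Measurable fun s : Fin n → ℝ => s ⬝ᵥ u :=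
    (by fun_prop : Continuous fun s : Fin n → ℝ => s ⬝ᵥ u).measurable
  -- The scalar `s ⬝ᵥ u` is viewed as a family over `Unit` because the independence criterion
  -- compares two families coordinatewise.
  have hG : HasGaussianLaw (fun s : Fin n → ℝ =>
      ((fun i : Fin d => s ⬝ᵥ fun l => A l i), fun _ : Unit => s ⬝ᵥ u))
      (Measure.pi fun _ : Fin n => gaussianReal 0 v) := by
    have hid : HasGaussianLaw id (Measure.pi fun _ : Fin n => gaussianReal 0 v) :=
      IsGaussian.hasGaussianLaw_id
    exact hid.map_fun (LinearMap.toContinuousLinearMap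
      ((LinearMap.pi fun i : Fin d => (dotProductBilin ℝ ℝ).flip fun l => A l i).prod
        (LinearMap.pi fun _ : Unit => (dotProductBilin ℝ ℝ).flip u)))
  have hind := hG.indepFun_of_covariance_eval fun i _ => by
    rw [covariance_dotProduct_gaussian]
    have : (fun l => A l i) ⬝ᵥ u = 0 := congrFun hu i
    rw [this, mul_zero]
  have hind' := hind.comp measurable_id (measurable_pi_apply ())
  have := hind'.map_prod_eq_prod_map_map (hm1.aemeasurable) (hm2.aemeasurable)
  rw [← map_dotProduct_gaussian v u hr]
  exact this

end GaussianRow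

/-! ### The joint law of `S A` and `S u` -/

/-- The law of the sketched design matrix `S A`. -/
noncomputable def sketchedDesign {n d : ℕ} (m : ℕ) (A : Matrix (Fin n) (Fin d) ℝ) :
    Measure (Matrix (Fin m) (Fin d) ℝ) :=
  Measure.pi fun _ : Fin m =>
    (Measure.pi fun _ : Fin n => gaussianReal 0 ((1 : ℝ≥0) / (m : ℝ≥0))).map fun s => s ᵥ* A

section SketchedDesign

variable {m n d : ℕ} (A : Matrix (Fin n) (Fin d) ℝ)

instance isProbabilityMeasure_map_vecMul (v : ℝ≥0) : IsProbabilityMeasure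
    ((Measure.pi fun _ : Fin n => gaussianReal 0 v).map fun s => s ᵥ* A) :=
  Measure.isProbabilityMeasure_map
    (by fun_prop : Continuous fun s : Fin n → ℝ => s ᵥ* A).aemeasurable

instance isProbabilityMeasure_sketchedDesign : IsProbabilityMeasure (sketchedDesign m A) :=
  inferInstanceAs (IsProbabilityMeasure (Measure.pi fun _ : Fin m =>
    (Measure.pi fun _ : Fin n => gaussianReal 0 ((1 : ℝ≥0) / (m : ℝ≥0))).map fun s => s ᵥ* A))

theorem memLp_sketchedDesign (k : Fin m) (i : Fin d) :
    MemLp (fun Z : Matrix (Fin m) (Fin d) ℝ => Z k i) 2 (sketchedDesign m A) := by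
  have h1 : MemLp (fun z : Fin d → ℝ => z i) 2
      ((Measure.pi fun _ : Fin n => gaussianReal 0 ((1 : ℝ≥0) / (m : ℝ≥0))).map
        fun s => s ᵥ* A) := by
    rw [memLp_map_measure_iff (measurable_pi_apply i).aestronglyMeasurable
      (by fun_prop : Continuous fun s : Fin n → ℝ => s ᵥ* A).aemeasurable]
    exact memLp_dotProduct_gaussian _ fun l => A l i
  exact h1.comp_measurePreserving (measurePreserving_eval (fun _ : Fin m =>
    (Measure.pi fun _ : Fin n => gaussianReal 0 ((1 : ℝ≥0) / (m : ℝ≥0))).map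
      fun s => s ᵥ* A) k)

/-- Each of the `m` rows contributes `AᵀA / m`. -/
theorem sum_integral_sketchedDesign (hm : 0 < m) (i j : Fin d) :
    ∑ k, ∫ Z, Z k i * Z k j ∂(sketchedDesign m A) = (Aᵀ * A) i j := by
  have h : ∀ k, ∫ Z, Z k i * Z k j ∂(sketchedDesign m A) = (m : ℝ)⁻¹ * (Aᵀ * A) i j := by
    intro k
    have h1 := integral_comp_eval (i := k) (f := fun z : Fin d → ℝ => z i * z j)
      (μ := fun _ : Fin m =>
        (Measure.pi fun _ : Fin n => gaussianReal 0 ((1 : ℝ≥0) / (m : ℝ≥0))).map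
          fun s => s ᵥ* A) (by fun_prop)
    rw [integral_map (by fun_prop : Continuous fun s : Fin n → ℝ => s ᵥ* A).aemeasurable
      (by fun_prop)] at h1
    refine h1.trans ((integral_dotProduct_mul_dotProduct_gaussian _
      (fun l => A l i) (fun l => A l j)).trans ?_)
    simp [Matrix.mul_apply, dotProduct]
  simp only [h, Finset.sum_const, Finset.card_univ, Fintype.card_fin, nsmul_eq_mul]
  have : (m : ℝ) ≠ 0 := by positivity
  field_simp

/-- The rows of `S` are independent, so the row statement tensorises; an array of pairs is then
regrouped as a pair of arrays. -/
theorem map_gaussianSketch (u : Fin n → ℝ) (hu : Aᵀ *ᵥ u = 0) {r : ℝ≥0}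
    (hr : (r : ℝ) = (u ⬝ᵥ u) / m) :
    (gaussianSketch m n).map (fun S => (S * A, S *ᵥ u)) =
      (sketchedDesign m A).prod (Measure.pi fun _ : Fin m => gaussianReal 0 r) := by
  have hm : Measurable fun s : Fin n → ℝ => (s ᵥ* A, s ⬝ᵥ u) :=
    (by fun_prop : Continuous fun s : Fin n → ℝ => (s ᵥ* A, s ⬝ᵥ u)).measurable
  have hrow := map_vecMul_dotProduct_gaussian ((1 : ℝ≥0) / (m : ℝ≥0)) A u hu (r := r) (by
    rw [hr]; push_cast; ring)
  have hfin : IsProbabilityMeasure ((Measure.pi fun _ : Fin n =>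
      gaussianReal 0 ((1 : ℝ≥0) / (m : ℝ≥0))).map fun s => (s ᵥ* A, s ⬝ᵥ u)) :=
    Measure.isProbabilityMeasure_map hm.aemeasurable
  have h1 := Measure.pi_map_pi (ι := Fin m)
    (μ := fun _ => Measure.pi fun _ : Fin n => gaussianReal 0 ((1 : ℝ≥0) / (m : ℝ≥0)))
    (f := fun _ s => (s ᵥ* A, s ⬝ᵥ u)) (fun _ => hm.aemeasurable)
  rw [hrow] at h1
  have h2 := (measurePreserving_arrowProdEquivProdArrow (Fin d → ℝ) ℝ (Fin m)
    (fun _ => (Measure.pi fun _ : Fin n => gaussianReal 0 ((1 : ℝ≥0) / (m : ℝ≥0))).map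
      fun s => s ᵥ* A) (fun _ => gaussianReal 0 r)).map_eq
  have hmS : Measurable fun (S : Fin m → Fin n → ℝ) (k : Fin m) => (S k ᵥ* A, S k ⬝ᵥ u) :=
    measurable_pi_lambda _ fun k => hm.comp (measurable_pi_apply k)
  rw [← h1, Measure.map_map (MeasurableEquiv.measurable _) hmS] at h2
  exact h2

end SketchedDesign

/-! ### The Gram matrix and its smallest eigenvalue -/

theorem l2norm_sq {k : ℕ} (v : Fin k → ℝ) : l2norm v ^ 2 = v ⬝ᵥ v := by
  rw [l2norm, EuclideanSpace.real_norm_sq_eq]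
  simp [dotProduct, pow_two]

theorem l2norm_nonneg {k : ℕ} (v : Fin k → ℝ) : 0 ≤ l2norm v := norm_nonneg _

section Gram

variable {n d : ℕ} (A : Matrix (Fin n) (Fin d) ℝ)

theorem dotProduct_gram_mulVec (x y : Fin d → ℝ) :
    x ⬝ᵥ ((Aᵀ * A) *ᵥ y) = (A *ᵥ x) ⬝ᵥ (A *ᵥ y) := by
  rw [← Matrix.mulVec_mulVec, Matrix.dotProduct_mulVec, Matrix.vecMul_transpose]

theorem mulVec_injective_of_rank_eq (hA : A.rank = d) : Function.Injective A.mulVec := by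
  rw [Matrix.mulVec_injective_iff, linearIndependent_iff_card_eq_finrank_span,
    Set.finrank, ← Matrix.rank_eq_finrank_span_cols, hA, Fintype.card_fin]

theorem pos_of_hasEigenvalue_gram (hA : A.rank = d) {μ : ℝ}
    (hμ : Module.End.HasEigenvalue (Matrix.toLin' (Aᵀ * A)) μ) : 0 < μ := by
  obtain ⟨x, hx⟩ := hμ.exists_hasEigenvector
  have h1 : (Aᵀ * A) *ᵥ x = μ • x := hx.apply_eq_smul
  have h2 : l2norm (A *ᵥ x) ^ 2 = μ * l2norm x ^ 2 := by
    rw [l2norm_sq, ← dotProduct_gram_mulVec, h1, dotProduct_smul, l2norm_sq, smul_eq_mul]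
  have hne : ∀ {k : ℕ} {v : Fin k → ℝ}, v ≠ 0 → 0 < l2norm v ^ 2 := fun {k v} hv => by
    rw [l2norm]
    have : 0 < ‖WithLp.toLp 2 v‖ := norm_pos_iff.2 (by simpa using hv)
    positivity
  have h3 : A *ᵥ x ≠ 0 := fun h => hx.2 (mulVec_injective_of_rank_eq A hA (by simpa using h))
  have := hne h3
  rw [h2] at this
  exact (pos_iff_pos_of_mul_pos this).2 (hne hx.2)

/-- The infimum of the Rayleigh quotient of a symmetric operator is an eigenvalue, hence at least
`sigmaMinGram A`. Positivity holds because the finite nonempty set of eigenvalues attains its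
infimum and full rank makes each eigenvalue positive. -/
theorem sigmaMinGram_pos_and_mul_le (hA : A.rank = d) (hd : 0 < d) :
    0 < sigmaMinGram A ∧
      ∀ x : Fin d → ℝ, sigmaMinGram A * l2norm x ^ 2 ≤ l2norm (A *ᵥ x) ^ 2 := by
  have : Nonempty (Fin d) := ⟨⟨0, hd⟩⟩
  set E : Set ℝ := {μ : ℝ | Module.End.HasEigenvalue (Matrix.toLin' (Aᵀ * A)) μ} with hE
  have hbdd : BddBelow E := ⟨0, fun μ hμ => (pos_of_hasEigenvalue_gram A hA hμ).le⟩
  have hherm : (Aᵀ * A).IsHermitian := by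
    have := Matrix.isHermitian_conjTranspose_mul_self A
    rwa [Matrix.conjTranspose_eq_transpose_of_trivial] at this
  have hsymm : (Matrix.toEuclideanLin (Aᵀ * A)).IsSymmetric :=
    Matrix.isSymmetric_toEuclideanLin_iff.2 hherm
  have hmin := hsymm.hasEigenvalue_iInf_of_finiteDimensional
  have hval : ∀ x : EuclideanSpace ℝ (Fin d),
      inner ℝ (Matrix.toEuclideanLin (Aᵀ * A) x) x = l2norm (A *ᵥ x.ofLp) ^ 2 := fun x => by
    rw [l2norm_sq, ← dotProduct_gram_mulVec]
    simp [Matrix.toEuclideanLin, EuclideanSpace.inner_eq_star_dotProduct]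
  simp only [hval, RCLike.re_to_real] at hmin
  set ι₀ := ⨅ x : {x : EuclideanSpace ℝ (Fin d) // x ≠ 0},
    l2norm (A *ᵥ x.1.ofLp) ^ 2 / ‖x.1‖ ^ 2 with hι
  have hmem : ι₀ ∈ E := by
    obtain ⟨x, hx⟩ := hmin.exists_hasEigenvector
    refine Module.End.hasEigenvalue_of_hasEigenvector (x := x.ofLp)
      ⟨Module.End.mem_eigenspace_iff.2 ?_, ?_⟩
    · have := congrArg WithLp.ofLp hx.apply_eq_smul
      simpa [Matrix.toEuclideanLin] using this
    · intro h
      exact hx.2 (by ext i; simpa using congrFun h i)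
  have hle : sigmaMinGram A ≤ ι₀ := csInf_le hbdd hmem
  refine ⟨?_, fun x => ?_⟩
  · have hfin : E.Finite := by
      have := Module.End.finite_hasEigenvalue (Matrix.toLin' (Aᵀ * A))
      exact this
    exact pos_of_hasEigenvalue_gram A hA (Set.Nonempty.csInf_mem ⟨ι₀, hmem⟩ hfin)
  · by_cases hx : x = 0
    · subst hx; simp [l2norm_sq]
    have hx' : WithLp.toLp 2 x ≠ 0 := by simpa using hx
    have hb : BddBelow (Set.range fun x : {x : EuclideanSpace ℝ (Fin d) // x ≠ 0} =>
        l2norm (A *ᵥ x.1.ofLp) ^ 2 / ‖x.1‖ ^ 2) :=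
      ⟨0, by rintro _ ⟨y, rfl⟩; positivity⟩
    have h1 : ι₀ ≤ l2norm (A *ᵥ x) ^ 2 / l2norm x ^ 2 := ciInf_le hb ⟨WithLp.toLp 2 x, hx'⟩
    have hpos : 0 < l2norm x := norm_pos_iff.2 hx'
    exact (le_div_iff₀ (by positivity)).1 (hle.trans h1)

theorem isUnit_det_gram (hA : A.rank = d) : IsUnit (Aᵀ * A).det := by
  rw [← Matrix.isUnit_iff_isUnit_det, ← Matrix.mulVec_injective_iff_isUnit]
  intro x y hxy
  have h : (Aᵀ * A) *ᵥ (x - y) = 0 := by rw [Matrix.mulVec_sub]; exact sub_eq_zero.2 hxy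
  have h1 := dotProduct_gram_mulVec A (x - y) (x - y)
  rw [h, dotProduct_zero, eq_comm, dotProduct_self_eq_zero] at h1
  exact sub_eq_zero.1 (mulVec_injective_of_rank_eq A hA (by simpa using h1))

theorem isSymm_inv_gram : ((Aᵀ * A)⁻¹)ᵀ = (Aᵀ * A)⁻¹ := by
  rw [Matrix.transpose_nonsing_inv, Matrix.transpose_mul, Matrix.transpose_transpose]

/-- With `z = (AᵀA)⁻¹ x`, expand `0 ≤ ‖x - σ z‖²` and use `σ ‖z‖² ≤ ‖A z‖² = z·x`. -/
theorem dotProduct_inv_gram_mulVec_le (hA : A.rank = d) (hd : 0 < d) (x : Fin d → ℝ) :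
    sigmaMinGram A * (x ⬝ᵥ ((Aᵀ * A)⁻¹ *ᵥ x)) ≤ x ⬝ᵥ x := by
  obtain ⟨hσ, hle⟩ := sigmaMinGram_pos_and_mul_le A hA hd
  set z := (Aᵀ * A)⁻¹ *ᵥ x with hz
  have hx : (Aᵀ * A) *ᵥ z = x := by
    rw [hz, Matrix.mulVec_mulVec, Matrix.mul_nonsing_inv _ (isUnit_det_gram A hA),
      Matrix.one_mulVec]
  have h1 := hle z
  rw [l2norm_sq, l2norm_sq, ← dotProduct_gram_mulVec A z z, hx] at h1
  set σ := sigmaMinGram A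
  have h2 : 0 ≤ (x - σ • z) ⬝ᵥ (x - σ • z) := by
    rw [← l2norm_sq]; positivity
  have h3 : (x - σ • z) ⬝ᵥ (x - σ • z) = x ⬝ᵥ x - 2 * σ * (z ⬝ᵥ x) + σ ^ 2 * (z ⬝ᵥ z) := by
    simp only [sub_dotProduct, dotProduct_sub, smul_dotProduct, dotProduct_smul, smul_eq_mul,
      dotProduct_comm x z]
    ring
  rw [dotProduct_comm x z]
  have h4 := mul_le_mul_of_nonneg_left h1 hσ.le
  nlinarith

theorem trace_inv_gram_le (hA : A.rank = d) (hd : 0 < d) :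
    ((Aᵀ * A)⁻¹).trace ≤ d / sigmaMinGram A := by
  obtain ⟨hσ, -⟩ := sigmaMinGram_pos_and_mul_le A hA hd
  have h : ∀ i, (Aᵀ * A)⁻¹ i i ≤ (sigmaMinGram A)⁻¹ := fun i => by
    have := dotProduct_inv_gram_mulVec_le A hA hd (Pi.single i 1)
    simp only [Matrix.mulVec_single_one, single_one_dotProduct, Matrix.col_apply,
      Pi.single_eq_same] at this
    rw [← mul_le_mul_iff_right₀ hσ, mul_inv_cancel₀ hσ.ne']
    exact this
  calc ((Aᵀ * A)⁻¹).trace ≤ ∑ _ : Fin d, (sigmaMinGram A)⁻¹ := Finset.sum_le_sum fun i _ => h i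
    _ = d / sigmaMinGram A := by simp [div_eq_mul_inv]

end Gram

/-- This is `0 ≤ ‖A (x - c z)‖²` with `z = (AᵀA)⁻¹ s`. Weighting the score by the inverse Gram
matrix makes the prediction norm appear directly. -/
theorem two_mul_dotProduct_le {n d : ℕ} (A : Matrix (Fin n) (Fin d) ℝ) (hA : A.rank = d)
    (c : ℝ) (x s : Fin d → ℝ) :
    2 * c * (x ⬝ᵥ s) ≤ l2norm (A *ᵥ x) ^ 2 + c ^ 2 * (s ⬝ᵥ ((Aᵀ * A)⁻¹ *ᵥ s)) := by
  set z := (Aᵀ * A)⁻¹ *ᵥ s with hz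
  have hs : (Aᵀ * A) *ᵥ z = s := by
    rw [hz, Matrix.mulVec_mulVec, Matrix.mul_nonsing_inv _ (isUnit_det_gram A hA),
      Matrix.one_mulVec]
  have h1 : (A *ᵥ x) ⬝ᵥ (A *ᵥ z) = x ⬝ᵥ s := by rw [← dotProduct_gram_mulVec A x z, hs]
  have h2 : (A *ᵥ z) ⬝ᵥ (A *ᵥ z) = s ⬝ᵥ z := by
    rw [← dotProduct_gram_mulVec A z z, hs, dotProduct_comm]
  have h3 : 0 ≤ l2norm (A *ᵥ (x - c • z)) ^ 2 := by positivity
  rw [l2norm_sq, Matrix.mulVec_sub, Matrix.mulVec_smul] at h3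
  simp only [sub_dotProduct, dotProduct_sub, smul_dotProduct, dotProduct_smul, smul_eq_mul,
    dotProduct_comm (A *ᵥ z) (A *ᵥ x), h1, h2] at h3
  rw [l2norm_sq]
  linarith

theorem measurable_matrix_apply {m n : ℕ} (k : Fin m) (i : Fin n) :
    Measurable fun Z : Matrix (Fin m) (Fin n) ℝ => Z k i :=
  (measurable_pi_apply i).comp (measurable_pi_apply k)

theorem measurable_matrix_mulVec {m d : ℕ} :
    Measurable fun z : Matrix (Fin m) (Fin d) ℝ × (Fin d → ℝ) => z.1 *ᵥ z.2 :=
  measurable_pi_lambda _ fun k => by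
    change Measurable fun z : Matrix (Fin m) (Fin d) ℝ × (Fin d → ℝ) => ∑ i, z.1 k i * z.2 i
    refine Finset.measurable_fun_sum _ fun i _ => ?_
    exact ((measurable_matrix_apply k i).comp measurable_fst).mul
      ((measurable_pi_apply i).comp measurable_snd)

theorem measurable_l2norm {k : ℕ} : Measurable (l2norm : (Fin k → ℝ) → ℝ) := by
  unfold l2norm
  fun_prop

/-! ### The van Trees bound and the worst case -/

section BayesRisk

variable {m n d : ℕ} (A : Matrix (Fin n) (Fin d) ℝ) (est : SketchEstimator m d)

/-- The error of the estimator `est` as a function of the sketched design, the parameter and the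
sketched residual. -/
noncomputable def estimationError
    (z : Matrix (Fin m) (Fin d) ℝ × (Fin d → ℝ) × (Fin m → ℝ)) : Fin d → ℝ :=
  est (z.1, z.1 *ᵥ z.2.1 + z.2.2) - z.2.1

theorem measurable_estimationError (hest : Measurable est) : Measurable (estimationError est) := by
  unfold estimationError
  refine (hest.comp (measurable_fst.prodMk (.add ?_ (measurable_snd.comp measurable_snd)))).sub
    (measurable_fst.comp measurable_snd)
  exact measurable_matrix_mulVec.comp
    (measurable_fst.prodMk (measurable_fst.comp measurable_snd))

theorem measurable_sq_l2norm_estimationError (hest : Measurable est) :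
    Measurable fun z => l2norm (A *ᵥ estimationError est z) ^ 2 := by
  have hc : Measurable fun x : Fin d → ℝ => A *ᵥ x :=
    (by fun_prop : Continuous fun x : Fin d → ℝ => A *ᵥ x).measurable
  exact (measurable_l2norm.comp (hc.comp (measurable_estimationError est hest))).pow_const 2

/-- **Van Trees inequality** for the prediction error in a Gaussian linear model with random
design. -/
theorem le_integral_prediction_error (hA : A.rank = d) (hd : 0 < d) (hest : Measurable est)
    {ρ τ : ℝ → ℝ} {J : ℝ} (h : IsScoreDensity ρ τ J) (hJ : 0 ≤ J) {v : ℝ≥0} (hv : v ≠ 0)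
    {Q : Measure (Matrix (Fin m) (Fin d) ℝ)} [IsProbabilityMeasure Q]
    (hQ : ∀ k i, MemLp (fun Z : Matrix (Fin m) (Fin d) ℝ => Z k i) 2 Q)
    (hM : ∀ i j, ∑ k, ∫ Z, Z k i * Z k j ∂Q = (Aᵀ * A) i j)
    (hint : Integrable (fun z => l2norm (A *ᵥ estimationError est z) ^ 2)
      (Q.prod ((Measure.pi fun _ : Fin d => densityMeasure ρ).prod
        (Measure.pi fun _ : Fin m => gaussianReal 0 v)))) :
    d / ((v : ℝ)⁻¹ + J / sigmaMinGram A) ≤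
      ∫ z, l2norm (A *ᵥ estimationError est z) ^ 2
        ∂(Q.prod ((Measure.pi fun _ : Fin d => densityMeasure ρ).prod
          (Measure.pi fun _ : Fin m => gaussianReal 0 v))) := by
  obtain ⟨hσ, hσle⟩ := sigmaMinGram_pos_and_mul_le A hA hd
  have := h.isProbabilityMeasure
  have hvpos : (0 : ℝ) < v := by positivity
  set P := Q.prod ((Measure.pi fun _ : Fin d => densityMeasure ρ).prod
    (Measure.pi fun _ : Fin m => gaussianReal 0 v)) with hP
  set s : Matrix (Fin m) (Fin d) ℝ × (Fin d → ℝ) × (Fin m → ℝ) → Fin d → ℝ :=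
    fun z i => jointScore v τ z.1 z.2.1 z.2.2 i with hs
  have hsL : ∀ i, MemLp (fun z => s z i) 2 P := memLp_jointScore h v hQ
  have hDm : ∀ i, Measurable fun z => estimationError est z i := fun i =>
    (measurable_pi_apply i).comp (measurable_estimationError est hest)
  -- Square integrability of the error follows from that of `A D`, since `σ_min ‖D‖² ≤ ‖A D‖²`.
  have hDL : ∀ i, MemLp (fun z => estimationError est z i) 2 P := fun i => by
    rw [memLp_two_iff_integrable_sq (hDm i).aestronglyMeasurable]
    refine (hint.const_mul (sigmaMinGram A)⁻¹).mono' ((hDm i).pow_const 2).aestronglyMeasurable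
      (.of_forall fun z => ?_)
    have h1 := hσle (estimationError est z)
    have h2 : estimationError est z i ^ 2 ≤ l2norm (estimationError est z) ^ 2 := by
      rw [l2norm_sq, dotProduct, pow_two]
      exact Finset.single_le_sum (f := fun i => estimationError est z i * estimationError est z i)
        (fun j _ => mul_self_nonneg _) (Finset.mem_univ i)
    rw [Real.norm_of_nonneg (by positivity), inv_mul_eq_div, le_div_iff₀ hσ, mul_comm]
    exact (mul_le_mul_of_nonneg_left h2 hσ.le).trans h1
  have hDI : ∀ i, Integrable (fun z => estimationError est z i * s z i) P := fun i =>
    (hDL i).integrable_mul (hsL i)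
  have hcross : ∫ z, estimationError est z ⬝ᵥ s z ∂P = d := by
    unfold dotProduct
    rw [integral_finsetSum _ fun i _ => hDI i]
    have h1 : ∀ i, ∫ z, estimationError est z i * s z i ∂P = 1 := fun i =>
      integral_estimator_mul_jointScore_random_design h hv Q (fun y => est y i) i (hDI i)
    simp [h1]
  have hcrossI : Integrable (fun z => estimationError est z ⬝ᵥ s z) P := by
    unfold dotProduct
    exact integrable_finsetSum _ fun i _ => hDI i
  set N := (Aᵀ * A)⁻¹ with hN
  have hquad : ∀ z, s z ⬝ᵥ (N *ᵥ s z) = ∑ i, ∑ j, N i j * (s z i * s z j) := fun z => by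
    simp only [dotProduct, Matrix.mulVec, Finset.mul_sum]
    exact Finset.sum_congr rfl fun i _ => Finset.sum_congr rfl fun j _ => by ring
  have hsI : ∀ i j, Integrable (fun z => N i j * (s z i * s z j)) P := fun i j =>
    ((hsL i).integrable_mul (hsL j)).const_mul _
  have hquadI : Integrable (fun z => s z ⬝ᵥ (N *ᵥ s z)) P := by
    simp only [hquad]
    exact integrable_finsetSum _ fun i _ => integrable_finsetSum _ fun j _ => hsI i j
  have hNsymm : Nᵀ = N := isSymm_inv_gram A
  have hquadV : ∫ z, s z ⬝ᵥ (N *ᵥ s z) ∂P = (v : ℝ)⁻¹ * d + J * N.trace := by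
    simp only [hquad]
    rw [integral_finsetSum _ fun i _ => integrable_finsetSum _ fun j _ => hsI i j]
    simp only [integral_finsetSum _ fun j _ => hsI _ j, integral_const_mul]
    have h1 : ∀ i j, ∫ z, s z i * s z j ∂P =
        (v : ℝ)⁻¹ * (Aᵀ * A) i j + J * (1 : Matrix (Fin d) (Fin d) ℝ) i j :=
      integral_jointScore_mul_jointScore h hv hQ hM
    -- The entrywise sum is the trace of `Nᵀ (AᵀA) = 1`.
    have h2 : ∑ i, ∑ j, N i j * (Aᵀ * A) i j = d := by
      have h3 : (Nᵀ * (Aᵀ * A)).trace = d := by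
        rw [hNsymm, hN, Matrix.nonsing_inv_mul _ (isUnit_det_gram A hA), Matrix.trace_one,
          Fintype.card_fin]
      rw [← h3, Matrix.trace, Finset.sum_comm]
      simp only [Matrix.diag_apply, Matrix.mul_apply (M := Nᵀ), Matrix.transpose_apply N]
    simp only [h1, mul_add, Finset.sum_add_distrib]
    congr 1
    · rw [← h2, Finset.mul_sum]
      refine Finset.sum_congr rfl fun i _ => ?_
      rw [Finset.mul_sum]
      exact Finset.sum_congr rfl fun j _ => by ring
    · simp [Matrix.one_apply, Matrix.trace, Finset.mul_sum, mul_comm]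
  have htr : N.trace ≤ d / sigmaMinGram A := trace_inv_gram_le A hA hd
  set a := (v : ℝ)⁻¹ + J / sigmaMinGram A with ha
  have hapos : 0 < a := by positivity
  have hquadle : ∫ z, s z ⬝ᵥ (N *ᵥ s z) ∂P ≤ d * a := by
    rw [hquadV, ha]
    have := mul_le_mul_of_nonneg_left htr hJ
    calc _ ≤ (v : ℝ)⁻¹ * d + J * (d / sigmaMinGram A) := by linarith
      _ = _ := by ring
  -- The choice `c = a⁻¹` maximises the resulting lower bound `2 c d - c² d a`, with value `d / a`.
  have hmono := integral_mono (hcrossI.const_mul (2 * a⁻¹))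
    (hint.add (hquadI.const_mul (a⁻¹ ^ 2)))
    fun z => two_mul_dotProduct_le A hA a⁻¹ (estimationError est z) (s z)
  rw [integral_const_mul, hcross, integral_add' hint (hquadI.const_mul _),
    integral_const_mul] at hmono
  have h5 := mul_le_mul_of_nonneg_left hquadle (sq_nonneg a⁻¹)
  have h6 : a⁻¹ ^ 2 * (d * a) = d / a := by field_simp
  have h7 : 2 * a⁻¹ * (d : ℝ) = 2 * (d / a) := by field_simp
  linarith

theorem predictionError_eq_lintegral (hest : Measurable est) {u : Fin n → ℝ} (hu : Aᵀ *ᵥ u = 0)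
    {v : ℝ≥0} (hv : (v : ℝ) = (u ⬝ᵥ u) / m) (x : Fin d → ℝ) :
    predictionError A est (A *ᵥ x + u) x =
      ∫⁻ z, ENNReal.ofReal (l2norm (A *ᵥ estimationError est (z.1, x, z.2)) ^ 2)
        ∂((sketchedDesign m A).prod (Measure.pi fun _ : Fin m => gaussianReal 0 v)) := by
  have hmS : Measurable fun S : Matrix (Fin m) (Fin n) ℝ => (S * A, S *ᵥ u) := by
    refine Measurable.prodMk (measurable_pi_lambda _ fun k => measurable_pi_lambda _ fun i => ?_)
      (measurable_matrix_mulVec.comp (measurable_id.prodMk measurable_const))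
    simp only [Matrix.mul_apply]
    exact Finset.measurable_fun_sum _ fun j _ => (measurable_matrix_apply k j).mul_const _
  have hF : Measurable fun z : Matrix (Fin m) (Fin d) ℝ × (Fin m → ℝ) =>
      ENNReal.ofReal (l2norm (A *ᵥ estimationError est (z.1, x, z.2)) ^ 2) :=
    ((measurable_sq_l2norm_estimationError A est hest).comp
      (measurable_fst.prodMk (measurable_const.prodMk measurable_snd))).ennreal_ofReal
  rw [← map_gaussianSketch A u hu hv, lintegral_map hF hmS, predictionError]
  simp only [estimationError, Matrix.mulVec_add, Matrix.mulVec_mulVec]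

theorem ae_mem_Icc_pi_densityMeasure {B : ℝ} (hB : 0 < B) :
    ∀ᵐ x ∂(Measure.pi fun _ : Fin d => densityMeasure (cosSqDensity B)),
      x ∈ Set.Icc (fun _ : Fin d => -B) (fun _ => B) := by
  have h := isScoreDensity_cosSqDensity hB
  have := h.isProbabilityMeasure
  have h1 : ∀ᵐ t ∂densityMeasure (cosSqDensity B), t ∈ Set.Icc (-B) B := by
    rw [densityMeasure, ae_withDensity_iff h.continuous.measurable.ennreal_ofReal]
    refine .of_forall fun t ht => ?_
    by_contra hn
    exact ht (by simp [cosSqDensity_of_notMem hn])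
  have h2 : ∀ i : Fin d, ∀ᵐ x ∂(Measure.pi fun _ : Fin d => densityMeasure (cosSqDensity B)),
      x i ∈ Set.Icc (-B) B := fun i =>
    (measurePreserving_eval (fun _ : Fin d => densityMeasure (cosSqDensity B))
      i).quasiMeasurePreserving.ae h1
  filter_upwards [ae_all_iff.2 h2] with x hx
  exact ⟨fun i => (hx i).1, fun i => (hx i).2⟩

/-- A uniform bound on the cube bounds the average over any prior supported there, so the van Trees
bound for the squared cosine prior lies below `W`. -/
theorem le_of_forall_predictionError_le (hm : 0 < m) (hA : A.rank = d) (hest : Measurable est)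
    {u : Fin n → ℝ} (hu : Aᵀ *ᵥ u = 0) {B : ℝ} (hB : 0 < B) {W : ℝ≥0∞}
    (hW : ∀ x ∈ Set.Icc (fun _ : Fin d => -B) (fun _ => B),
      predictionError A est (A *ᵥ x + u) x ≤ W) :
    ENNReal.ofReal ((d : ℝ) / m * l2norm u ^ 2 *
      (1 - Real.pi ^ 2 * l2norm u ^ 2 / (m * B ^ 2 * sigmaMinGram A))) ≤ W := by
  rcases Nat.eq_zero_or_pos d with rfl | hd
  · simp
  by_cases hr : l2norm u = 0
  · simp [hr]
  -- A finite `W` is what makes the squared error integrable below.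
  rcases eq_or_ne W ∞ with rfl | hWtop
  · exact le_top
  have hrpos : 0 < l2norm u := lt_of_le_of_ne (l2norm_nonneg u) (Ne.symm hr)
  have hmpos : (0 : ℝ) < m := by exact_mod_cast hm
  obtain ⟨hσ, -⟩ := sigmaMinGram_pos_and_mul_le A hA hd
  have h := isScoreDensity_cosSqDensity hB
  have := h.isProbabilityMeasure
  set v : ℝ≥0 := ⟨l2norm u ^ 2 / m, by positivity⟩ with hvdef
  have hv : (v : ℝ) = (u ⬝ᵥ u) / m := by rw [← l2norm_sq]; rfl
  have hv0 : v ≠ 0 := by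
    have : (0 : ℝ) < v := by change 0 < l2norm u ^ 2 / m; positivity
    exact_mod_cast this.ne'
  set π₀ := Measure.pi fun _ : Fin d => densityMeasure (cosSqDensity B) with hπ₀
  set G := Measure.pi fun _ : Fin m => gaussianReal 0 v with hG
  set Q := sketchedDesign m A with hQ
  have hmeas := measurable_sq_l2norm_estimationError A est hest
  -- Tonelli brings the parameter outermost, where the inner integral is the prediction error at `A
  -- x + u`.
  have hlin : ∫⁻ z, ENNReal.ofReal (l2norm (A *ᵥ estimationError est z) ^ 2)
      ∂(Q.prod (π₀.prod G)) ≤ W := by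
    have hm' := hmeas.ennreal_ofReal
    calc _ = ∫⁻ Z, ∫⁻ x, ∫⁻ w, ENNReal.ofReal (l2norm (A *ᵥ estimationError est (Z, x, w)) ^ 2)
            ∂G ∂π₀ ∂Q := by
          rw [lintegral_prod _ hm'.aemeasurable]
          refine lintegral_congr fun Z => ?_
          exact lintegral_prod _ (hm'.comp measurable_prodMk_left).aemeasurable
      _ = ∫⁻ x, ∫⁻ Z, ∫⁻ w, ENNReal.ofReal (l2norm (A *ᵥ estimationError est (Z, x, w)) ^ 2)
            ∂G ∂Q ∂π₀ := by
          refine lintegral_lintegral_swap (Measurable.aemeasurable ?_)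
          refine Measurable.lintegral_prod_right' (f := fun p : (Matrix (Fin m) (Fin d) ℝ ×
            (Fin d → ℝ)) × (Fin m → ℝ) =>
              ENNReal.ofReal (l2norm (A *ᵥ estimationError est (p.1.1, p.1.2, p.2)) ^ 2)) ?_
          exact hm'.comp ((measurable_fst.comp measurable_fst).prodMk
            ((measurable_snd.comp measurable_fst).prodMk measurable_snd))
      _ = ∫⁻ x, predictionError A est (A *ᵥ x + u) x ∂π₀ := by
          refine lintegral_congr fun x => ?_
          rw [predictionError_eq_lintegral A est hest hu hv, lintegral_prod]
          exact (hm'.comp (measurable_fst.prodMk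
            (measurable_const.prodMk measurable_snd))).aemeasurable
      _ ≤ ∫⁻ _, W ∂π₀ :=
          lintegral_mono_ae ((ae_mem_Icc_pi_densityMeasure hB).mono fun x hx => hW x hx)
      _ = W := by simp
  have hint : Integrable (fun z => l2norm (A *ᵥ estimationError est z) ^ 2)
      (Q.prod (π₀.prod G)) := by
    refine ⟨hmeas.aestronglyMeasurable, ?_⟩
    rw [hasFiniteIntegral_iff_ofReal (.of_forall fun z => sq_nonneg _)]
    exact hlin.trans_lt (lt_top_iff_ne_top.2 hWtop)
  rw [← ofReal_integral_eq_lintegral_ofReal hint (.of_forall fun z => sq_nonneg _)] at hlin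
  refine (ENNReal.ofReal_le_ofReal ?_).trans hlin
  refine le_trans ?_ (le_integral_prediction_error A est hA hd hest h (by positivity) hv0
    (memLp_sketchedDesign A) (sum_integral_sketchedDesign A hm) hint)
  have hvv : (v : ℝ) = l2norm u ^ 2 / m := rfl
  rw [hvv]
  set r := l2norm u
  set σ := sigmaMinGram A
  set t := Real.pi ^ 2 * r ^ 2 / (m * B ^ 2 * σ) with ht
  have htn : 0 ≤ t := by positivity
  -- The van Trees bound becomes `d / m * r ^ 2 / (1 + t)`, and `(1 - t) * (1 + t) ≤ 1` finishes.
  have e1 : (r ^ 2 / m)⁻¹ + Real.pi ^ 2 / B ^ 2 / σ = m / r ^ 2 * (1 + t) := by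
    rw [ht]; field_simp
  have e2 : (d : ℝ) / (m / r ^ 2 * (1 + t)) = d / m * r ^ 2 * (1 / (1 + t)) := by
    field_simp
  rw [e1, e2]
  refine mul_le_mul_of_nonneg_left ?_ (by positivity)
  rw [le_div_iff₀ (by positivity)]
  nlinarith

theorem le_of_forall_predictionError_le_unconstrained (hm : 0 < m) (hA : A.rank = d)
    (hest : Measurable est) {u : Fin n → ℝ} (hu : Aᵀ *ᵥ u = 0) {W : ℝ≥0∞}
    (hW : ∀ x, predictionError A est (A *ᵥ x + u) x ≤ W) :
    ENNReal.ofReal ((d : ℝ) / m * l2norm u ^ 2) ≤ W := by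
  have hlim : Filter.Tendsto (fun B : ℝ => ENNReal.ofReal ((d : ℝ) / m * l2norm u ^ 2 *
      (1 - Real.pi ^ 2 * l2norm u ^ 2 / (m * B ^ 2 * sigmaMinGram A)))) Filter.atTop
      (nhds (ENNReal.ofReal ((d : ℝ) / m * l2norm u ^ 2))) := by
    refine (ENNReal.continuous_ofReal.tendsto _).comp ?_
    have h1 : Filter.Tendsto (fun B : ℝ => (B ^ 2)⁻¹) Filter.atTop (nhds 0) :=
      (Filter.tendsto_pow_atTop two_ne_zero).inv_tendsto_atTop
    have h2 := ((h1.const_mul (Real.pi ^ 2 * l2norm u ^ 2 / (m * sigmaMinGram A))).const_sub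
      1).const_mul ((d : ℝ) / m * l2norm u ^ 2)
    simp only [mul_zero, sub_zero, mul_one] at h2
    refine h2.congr fun B => ?_
    congr 2
    rw [← div_eq_mul_inv, div_div]
    congr 1
    ring
  refine le_of_tendsto hlim ?_
  filter_upwards [Filter.eventually_gt_atTop 0] with B hB
  exact le_of_forall_predictionError_le A est hm hA hest hu hB fun x _ => hW x

/-- By Pythagoras `‖A (z - x) - u‖² = ‖A (z - x)‖² + ‖u‖²`; only membership of `x` in `C` matters.
-/
theorem isLeastSquaresSolution_add_of_orthogonal {C : Set (Fin d → ℝ)} {x : Fin d → ℝ}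
    (hx : x ∈ C) {u : Fin n → ℝ} (hu : Aᵀ *ᵥ u = 0) :
    IsLeastSquaresSolution A C (A *ᵥ x + u) x := by
  refine ⟨hx, fun z _ => ?_⟩
  have h1 : A *ᵥ x - (A *ᵥ x + u) = -u := by abel
  have h2 : A *ᵥ z - (A *ᵥ x + u) = A *ᵥ (z - x) - u := by rw [Matrix.mulVec_sub]; abel
  have h3 : (A *ᵥ (z - x)) ⬝ᵥ u = 0 := by
    rw [dotProduct_comm, Matrix.dotProduct_mulVec, ← Matrix.mulVec_transpose, hu, zero_dotProduct]
  have h4 : 0 ≤ l2norm (A *ᵥ (z - x)) ^ 2 := sq_nonneg _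
  rw [l2norm_sq] at h4
  rw [h1, h2, l2norm_sq, l2norm_sq]
  simp only [neg_dotProduct, dotProduct_neg, sub_dotProduct, dotProduct_sub, h3,
    dotProduct_comm u (A *ᵥ (z - x))]
  linarith

theorem predictionError_le_worstCaseError {C : Set (Fin d → ℝ)} {x : Fin d → ℝ} (hx : x ∈ C)
    {u : Fin n → ℝ} (hu : Aᵀ *ᵥ u = 0) {R : Set (Fin n → ℝ)} (huR : u ∈ R) :
    predictionError A est (A *ᵥ x + u) x ≤ worstCaseError A C R est :=
  le_iSup₂_of_le (A *ᵥ x + u) x <| le_iSup₂_of_le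
    (isLeastSquaresSolution_add_of_orthogonal A hx hu) (by simpa using huR) le_rfl

/-- As `d < n`, the kernel of `Aᵀ` contains a nonzero vector, which can be rescaled. This reduces
the fixed-norm suprema to the fixed-residual ones. -/
theorem exists_orthogonal_of_l2norm_eq (hdn : d < n) {r : ℝ} (hr : 0 ≤ r) :
    ∃ u : Fin n → ℝ, Aᵀ *ᵥ u = 0 ∧ l2norm u = r := by
  have hker : LinearMap.ker (Matrix.toLin' Aᵀ) ≠ ⊥ :=
    LinearMap.ker_ne_bot_of_finrank_lt (by simpa using hdn)
  obtain ⟨w, hw, hw0⟩ := Submodule.exists_mem_ne_zero_of_ne_bot hker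
  have hpos : 0 < l2norm w := norm_pos_iff.2 (by simpa using hw0)
  have hw' : Aᵀ *ᵥ w = 0 := by simpa using hw
  refine ⟨(r / l2norm w) • w, by rw [Matrix.mulVec_smul, hw', smul_zero], ?_⟩
  have : l2norm ((r / l2norm w) • w) = |r / l2norm w| * l2norm w := by
    rw [l2norm, WithLp.toLp_smul, norm_smul, Real.norm_eq_abs, l2norm]
  rw [this, abs_of_nonneg (by positivity), div_mul_cancel₀ _ hpos.ne']

end BayesRisk

theorem theorem2 (m n d : ℕ) (hm : 0 < m) (hdn : d < n)
    (A : Matrix (Fin n) (Fin d) ℝ) (hA : A.rank = d)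
    (est : SketchEstimator m d) (hest : Measurable est) :
    -- constrained problem, constraint set containing the cube `[-B, B]^d`
    (∀ C : Set (Fin d → ℝ), Convex ℝ C → ∀ B : ℝ, 0 < B →
      Set.Icc (fun _ => -B) (fun _ => B) ⊆ C →
      -- worst case for a fixed residual vector `u = y - A x_LS` orthogonal to the range of `A`
      (∀ u : Fin n → ℝ, Aᵀ *ᵥ u = 0 →
        ENNReal.ofReal ((d : ℝ) / m * l2norm u ^ 2 *
            (1 - Real.pi ^ 2 * l2norm u ^ 2 / (m * B ^ 2 * sigmaMinGram A)))
          ≤ worstCaseError A C {u} est) ∧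
      -- worst case for a fixed residual norm `r = ‖y - A x_LS‖₂`
      (∀ r : ℝ, 0 ≤ r →
        ENNReal.ofReal ((d : ℝ) / m * r ^ 2 *
            (1 - Real.pi ^ 2 * r ^ 2 / (m * B ^ 2 * sigmaMinGram A)))
          ≤ worstCaseError A C {v | l2norm v = r} est)) ∧
    -- unconstrained problem
    (∀ u : Fin n → ℝ, Aᵀ *ᵥ u = 0 →
      ENNReal.ofReal ((d : ℝ) / m * l2norm u ^ 2) ≤ worstCaseError A Set.univ {u} est) ∧
    (∀ r : ℝ, 0 ≤ r →
      ENNReal.ofReal ((d : ℝ) / m * r ^ 2) ≤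
        worstCaseError A Set.univ {v | l2norm v = r} est) := by
  refine ⟨fun C _ B hB hC => ⟨fun u hu => ?_, fun r hr => ?_⟩, fun u hu => ?_, fun r hr => ?_⟩
  · exact le_of_forall_predictionError_le A est hm hA hest hu hB fun x hx =>
      predictionError_le_worstCaseError A est (hC hx) hu rfl
  · obtain ⟨u, hu, rfl⟩ := exists_orthogonal_of_l2norm_eq A hdn hr
    exact le_of_forall_predictionError_le A est hm hA hest hu hB fun x hx =>
      predictionError_le_worstCaseError A est (hC hx) hu rfl
  · exact le_of_forall_predictionError_le_unconstrained A est hm hA hest hu fun x =>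
      predictionError_le_worstCaseError A est (Set.mem_univ x) hu rfl
  · obtain ⟨u, hu, rfl⟩ := exists_orthogonal_of_l2norm_eq A hdn hr
    exact le_of_forall_predictionError_le_unconstrained A est hm hA hest hu fun x =>
      predictionError_le_worstCaseError A est (Set.mem_univ x) hu rfl
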